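/- Let $a,b>-1$ be real. For $n\ge 1$ put $h=\frac{1}{2n+a+b+1}$ and $x_i=h(a+b+i)$, $i=1,\dots,2n$. For $i\ge1$ let $\bar\theta_i,\bar\phi_i\in[0,\frac{\pi}{2}]$ be the angles with $\bar c_i=\cos\bar\theta_i=\sqrt{\tfrac{a+i}{a+b+2i}}$ and $\bar c_i'=\cos\bar\phi_i=\sqrt{\tfrac{i}{a+b+1+2i}}$, and put $\bar s_i=\sin\bar\theta_i$, $\bar s_i'=\sin\bar\phi_i$. Let $J^{\infty,a,b}$ be the $2n$-by-$2n$ $\infty$-Jacobi matrix model $$J^{\infty,a,b}=\left[\begin{array}{cccc|cccc} \bar c_{n} & -\bar s_{n}\bar c'_{n-1} & & & \bar s_{n}\bar s'_{n-1}\\ & \bar c_{n-1}\bar s'_{n-1} & \ddots & & \bar c_{n-1}\bar c'_{n-1} & \ddots\\ & & \ddots & -\bar s_{2}\bar c'_{1} & & \ddots & \bar s_{2}\bar s'_{1}\\ & & & \bar c_{1}\bar s'_{1} & & & \bar c_{1}\bar c'_{1} & \bar s_{1}\\ \hline -\bar s_{n} & -\bar c_{n}\bar c'_{n-1} & & & \bar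 c_{n}\bar s'_{n-1}\\ & -\bar s_{n-1}\bar s'_{n-1} & \ddots & & -\bar s_{n-1}\bar c'_{n-1} & \ddots\\ & & \ddots & -\bar c_{2}\bar c'_{1} & & \ddots & \bar c_{2}\bar s'_{1}\\ & & & -\bar s_{1}\bar s'_{1} & & & -\bar s_{1}\bar c'_{1} & \bar c_{1}\end{array}\right]$$ (for $n=1$ its four blocks are $\bar c_1,\bar s_1,-\bar s_1,\bar c_1$), let $B_{22}^{\infty,a,b}$ be its bottom-right $n$-by-$n$ block, let $F$ be the $n$-by-$n$ flip matrix (ones on the antidiagonal, zeros elsewhere), and let $$J_{\mathrm{hard}}^{\infty,a,b}=\frac1h\,F B_{22}^{\infty,a,b}F .$$ Let $\nabla$ be the $n$-by-$n$ upper bidiagonal matrix with $-1$ on the main diagonal and $1$ on the superdiagonal, let $\Omega=\operatorname{diag}(-1,1,-1,1,\dots)$, and let $S=-\frac12\Omega\nabla\Omega$ (all entries on the main diagonal and superdiagonal equal $\frac12$). (1) Define the $n$-by-$n$ matrix $E$ by $$J_{\mathrm{hard}}^{\infty,a,b}=-\frac{1}{2h}\nabla+\Bigl(a+\frac12\Bigr)\operatorname{diag}\Bigl(\frac1{x_2},\frac1{x_4},\dots,\frac1{x_{2n}}\Bigr)S+E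 .$$ Then $E$ is upper bidiagonal, and for each fixed $\varepsilon>0$ the entries of $E$ in rows $\lceil\varepsilon/h\rceil,\dots,n$ are uniformly $O(h)$: there is a constant $C=C(a,b,\varepsilon)$ such that $|E_{ij}|\le Ch$ for all $n\ge1$, all $i$ with $\lceil\varepsilon/h\rceil\le i\le n$ and all $j$. (2) Let $j_a(x)=\sum_{m\ge0}\frac{(-1)^m}{m!\,\Gamma(m+a+1)}\bigl(\frac x2\bigr)^{2m+a}$ be the Bessel function of the first kind of order $a$. Consider the classical Bessel operator in Liouville normal form on $(0,1)$, with its adjoint, $$\tilde{\mathcal J}_a^\infty=-\frac{d}{dx}+\Bigl(a+\frac12\Bigr)\frac1x,\qquad(\tilde{\mathcal J}_a^\infty)^*=\frac{d}{dx}+\Bigl(a+\frac12\Bigr)\frac1x ,$$ with type (i) boundary conditions, imposed in the original variable: if $w(x)=x^{-1/4}v(\sqrt x)$ (that is, $v(x)=\sqrt x\,w(x^2)$) and $\mathcal J_a^\infty=-2\sqrt x\frac{d}{dx}+\frac a{\sqrt x}$, then $\lim_{x\to1^-}w(x)=0$ and $\lim_{x\to0^+}(\mathcal J_a^\infty w)(x)=0$.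 Its singular values are the numbers $\sigma\ge0$ for which there are differentiable, square integrable functions $v,u$ on $(0,1)$, with $v\not\equiv0$ and $v$ satisfying the boundary conditions, such that $\tilde{\mathcal J}_a^\infty v=\sigma u$ and $(\tilde{\mathcal J}_a^\infty)^*u=\sigma v$. Then these singular values are exactly the positive zeros of $j_a$, they form a strictly increasing sequence $\sigma_1<\sigma_2<\cdots$, and for each fixed $k\ge1$ the $k$-th least singular value of $J_{\mathrm{hard}}^{\infty,a,b}$ converges, as $n\to\infty$, to $\sigma_k$, the $k$-th least singular value of $\tilde{\mathcal J}_a^\infty$ with type (i) boundary conditions, which is the $k$-th positive zero of $j_a$. -/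

import Mathlib

open Set Filter Topology MeasureTheory

noncomputable section

namespace JacobiBessel

/-! ### The zero temperature Jacobi matrix model

Angles `θ̄ᵢ`, `φ̄ᵢ` are indexed by `i = 1, 2, …`; matrix indices in `Fin n` start at `0`, so that the
row with index `r : Fin n` is the row number `r + 1`. -/

/-- The angle `θ̄ᵢ ∈ [0, π/2]` with `cos θ̄ᵢ = √((a + i) / (a + b + 2 i))`. -/
def thetaBar (a b : ℝ) (i : ℕ) : ℝ :=
  Real.arccos (Real.sqrt ((a + i) / (a + b + 2 * i)))

/-- The angle `φ̄ᵢ ∈ [0, π/2]` with `cos φ̄ᵢ = √(i / (a + b + 1 + 2 i))`. -/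
def phiBar (a b : ℝ) (i : ℕ) : ℝ :=
  Real.arccos (Real.sqrt (i / (a + b + 1 + 2 * i)))

/-- `c̄ᵢ = cos θ̄ᵢ`. -/
def cBar (a b : ℝ) (i : ℕ) : ℝ := Real.cos (thetaBar a b i)

/-- `s̄ᵢ = sin θ̄ᵢ`. -/
def sBar (a b : ℝ) (i : ℕ) : ℝ := Real.sin (thetaBar a b i)

/-- `c̄'ᵢ = cos φ̄ᵢ`. -/
def cBar' (a b : ℝ) (i : ℕ) : ℝ := Real.cos (phiBar a b i)

/-- `s̄'ᵢ = sin φ̄ᵢ`. -/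
def sBar' (a b : ℝ) (i : ℕ) : ℝ := Real.sin (phiBar a b i)

/-- Top-left block: upper bidiagonal with diagonal `c̄ₙ, c̄ₙ₋₁ s̄'ₙ₋₁, …, c̄₁ s̄'₁` and superdiagonal
`-s̄ₙ c̄'ₙ₋₁, …, -s̄₂ c̄'₁`. -/
def jacobiB11 (n : ℕ) (a b : ℝ) : Matrix (Fin n) (Fin n) ℝ :=
  Matrix.of fun i j =>
    if j.val = i.val then
      (if i.val = 0 then cBar a b n else cBar a b (n - i) * sBar' a b (n - i))
    else if j.val = i.val + 1 then -(sBar a b (n - i) * cBar' a b (n - j))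
    else 0

/-- Top-right block: lower bidiagonal with diagonal `s̄ₙ s̄'ₙ₋₁, …, s̄₂ s̄'₁, s̄₁` and subdiagonal
`c̄ₙ₋₁ c̄'ₙ₋₁, …, c̄₁ c̄'₁`. -/
def jacobiB12 (n : ℕ) (a b : ℝ) : Matrix (Fin n) (Fin n) ℝ :=
  Matrix.of fun i j =>
    if j.val = i.val then
      (if i.val + 1 = n then sBar a b 1 else sBar a b (n - i) * sBar' a b (n - (i + 1)))
    else if i.val = j.val + 1 then cBar a b (n - i) * cBar' a b (n - i)
    else 0

/-- Bottom-left block: upper bidiagonal with diagonal `-s̄ₙ, -s̄ₙ₋₁ s̄'ₙ₋₁, …, -s̄₁ s̄'₁` and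
superdiagonal `-c̄ₙ c̄'ₙ₋₁, …, -c̄₂ c̄'₁`. -/
def jacobiB21 (n : ℕ) (a b : ℝ) : Matrix (Fin n) (Fin n) ℝ :=
  Matrix.of fun i j =>
    if j.val = i.val then
      (if i.val = 0 then -sBar a b n else -(sBar a b (n - i) * sBar' a b (n - i)))
    else if j.val = i.val + 1 then -(cBar a b (n - i) * cBar' a b (n - j))
    else 0

/-- Bottom-right block: lower bidiagonal with diagonal `c̄ₙ s̄'ₙ₋₁, …, c̄₂ s̄'₁, c̄₁` and subdiagonal
`-s̄ₙ₋₁ c̄'ₙ₋₁, …, -s̄₁ c̄'₁`. -/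
def jacobiB22 (n : ℕ) (a b : ℝ) : Matrix (Fin n) (Fin n) ℝ :=
  Matrix.of fun i j =>
    if j.val = i.val then
      (if i.val + 1 = n then cBar a b 1 else cBar a b (n - i) * sBar' a b (n - (i + 1)))
    else if i.val = j.val + 1 then -(sBar a b (n - i) * cBar' a b (n - i))
    else 0

/-- The `2n`-by-`2n` `∞`-Jacobi matrix model `J^{∞,a,b}`. -/
def jacobiModel (n : ℕ) (a b : ℝ) : Matrix (Fin n ⊕ Fin n) (Fin n ⊕ Fin n) ℝ :=
  Matrix.fromBlocks (jacobiB11 n a b) (jacobiB12 n a b) (jacobiB21 n a b) (jacobiB22 n a b)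

/-! ### Finite difference matrices -/

/-- `∇`: `-1` on the main diagonal, `1` on the superdiagonal. -/
def nabla (n : ℕ) : Matrix (Fin n) (Fin n) ℝ :=
  Matrix.of fun i j =>
    if j.val = i.val then -1 else if j.val = i.val + 1 then 1 else 0

/-- `Ω = diag(-1, 1, -1, 1, …)`. -/
def omega (n : ℕ) : Matrix (Fin n) (Fin n) ℝ :=
  Matrix.diagonal fun i => (-1) ^ (i.val + 1)

/-- The flip permutation matrix `F`, with ones from top-right to bottom-left. -/
def flip (n : ℕ) : Matrix (Fin n) (Fin n) ℝ :=
  Matrix.of fun i j => if j = i.rev then 1 else 0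

/-- The interpolating matrix `S = -½ Ω ∇ Ω`. -/
def interp (n : ℕ) : Matrix (Fin n) (Fin n) ℝ :=
  (-(1 / 2 : ℝ)) • (omega n * nabla n * omega n)

/-- `S` has `1/2` on the main diagonal and on the superdiagonal. -/
theorem interp_apply (n : ℕ) (i j : Fin n) :
    interp n i j = if j.val = i.val ∨ j.val = i.val + 1 then 1 / 2 else 0 := by
  have h : ∀ k : ℕ, ((-1 : ℝ) ^ k) * (-1) ^ k = 1 := fun k => by
    rw [← mul_pow]; norm_num
  simp only [interp, omega, nabla, Matrix.smul_apply, Matrix.mul_diagonal, Matrix.diagonal_mul,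
    Matrix.of_apply, smul_eq_mul]
  by_cases h1 : j.val = i.val
  · simp only [h1, if_true, true_or]
    linear_combination (1 / 2 : ℝ) * h (i.val + 1)
  · by_cases h2 : j.val = i.val + 1
    · simp only [h2, if_true, or_true]
      rw [if_neg (by omega), pow_succ (-1 : ℝ) (i.val + 1)]
      linear_combination (1 / 2 : ℝ) * h (i.val + 1)
    · simp [h1, h2]

/-- Entries that can be nonzero lie on the main diagonal or on the superdiagonal. -/
def IsUpperBidiagonal {n : ℕ} (A : Matrix (Fin n) (Fin n) ℝ) : Prop :=
  ∀ i j : Fin n, j.val ≠ i.val → j.val ≠ i.val + 1 → A i j = 0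

/-- Mesh size `h = 1 / (2n + a + b + 1)`. -/
def meshSize (n : ℕ) (a b : ℝ) : ℝ := 1 / (2 * n + a + b + 1)

/-- Grid points `xᵢ = h (a + b + i)`. -/
def gridPoint (n : ℕ) (a b : ℝ) (i : ℕ) : ℝ := meshSize n a b * (a + b + i)

/-- The `∞`-Jacobi matrix model scaled at the hard edge, `(1/h) F B₂₂ F`, where `B₂₂` is the
bottom-right block of the `∞`-Jacobi matrix model. -/
def jacobiHard (n : ℕ) (a b : ℝ) : Matrix (Fin n) (Fin n) ℝ :=
  (1 / meshSize n a b) • (flip n * (jacobiModel n a b).toBlocks₂₂ * flip n)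

/-- The `k`-th least singular value of a square matrix, `1 ≤ k ≤ n`, counted with multiplicity
(`LinearMap.singularValues` is nonincreasing and indexed from `0`). -/
def kthLeastSingularValue {n : ℕ} (A : Matrix (Fin n) (Fin n) ℝ) (k : ℕ) : ℝ :=
  (Matrix.toEuclideanLin A).singularValues (n - k)

/-! ### Bessel functions and the classical Bessel operator -/

/-- The Bessel function of the first kind of real order `a`, at `x > 0`:
`j_a(x) = ∑ₘ (-1)ᵐ / (m! Γ(m + a + 1)) (x/2)^(2m + a)`. -/
def besselJ (a x : ℝ) : ℝ :=
  ∑' m : ℕ, (-1) ^ m / (m.factorial * Real.Gamma (m + a + 1)) * (x / 2) ^ (2 * (m : ℝ) + a)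

/-- The classical Bessel operator `-2 √x d/dx + a / √x`. -/
def besselOp (a : ℝ) (w : ℝ → ℝ) (x : ℝ) : ℝ :=
  -2 * Real.sqrt x * deriv w x + a / Real.sqrt x * w x

/-- Type (i) boundary conditions: `w(1) = 0` and `(besselOp a w)(0) = 0`. -/
def TypeI (a : ℝ) (w : ℝ → ℝ) : Prop :=
  Tendsto w (𝓝[<] 1) (𝓝 0) ∧ Tendsto (besselOp a w) (𝓝[>] 0) (𝓝 0)

/-- The Bessel operator in Liouville normal form, `-d/dx + (a + 1/2) / x`. -/
def besselLiouville (a : ℝ) (v : ℝ → ℝ) (x : ℝ) : ℝ :=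
  -deriv v x + (a + 1 / 2) * (1 / x) * v x

/-- The action of its adjoint, `d/dx + (a + 1/2) / x`. -/
def besselLiouvilleAdj (a : ℝ) (u : ℝ → ℝ) (x : ℝ) : ℝ :=
  deriv u x + (a + 1 / 2) * (1 / x) * u x

/-- The change of variables to Liouville normal form is `v(x) = √x w(x²)`; this is its inverse,
`w(x) = x^(-1/4) v(√x)`. -/
def fromLiouville (v : ℝ → ℝ) (x : ℝ) : ℝ :=
  x ^ (-(1 / 4 : ℝ)) * v (Real.sqrt x)

/-- The change of variables carries one operator to the other:
`(besselLiouville a v)(t) = √t · (besselOp a w)(t²)` for `w = fromLiouville v`. -/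
theorem besselLiouville_eq (a : ℝ) (v : ℝ → ℝ) (t : ℝ) (ht : 0 < t)
    (hv : DifferentiableAt ℝ v t) :
    besselLiouville a v t = Real.sqrt t * besselOp a (fromLiouville v) (t ^ 2) := by
  have hs : Real.sqrt (t ^ 2) = t := Real.sqrt_sq ht.le
  have ht2 : 0 < t ^ 2 := by positivity
  have hp : (t ^ 2) ^ (-(1 / 4 : ℝ)) = (Real.sqrt t)⁻¹ := by
    rw [← Real.rpow_natCast t 2, ← Real.rpow_mul ht.le, Real.sqrt_eq_rpow, ← Real.rpow_neg ht.le]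
    norm_num
  have hp' : (t ^ 2) ^ (-(1 / 4 : ℝ) - 1) = (Real.sqrt t)⁻¹ / t ^ 2 := by
    rw [Real.rpow_sub_one ht2.ne', hp]
  have h1 : HasDerivAt (fun x : ℝ => x ^ (-(1 / 4 : ℝ)))
      (-(1 / 4 : ℝ) * (t ^ 2) ^ (-(1 / 4 : ℝ) - 1)) (t ^ 2) :=
    Real.hasDerivAt_rpow_const (Or.inl ht2.ne')
  have h2 : HasDerivAt Real.sqrt (1 / (2 * Real.sqrt (t ^ 2))) (t ^ 2) :=
    Real.hasDerivAt_sqrt ht2.ne'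
  have h3 : HasDerivAt v (deriv v t) (Real.sqrt (t ^ 2)) := by
    rw [hs]; exact hv.hasDerivAt
  have h4 : HasDerivAt (fromLiouville v) _ (t ^ 2) := h1.mul (h3.comp (t ^ 2) h2)
  have hst : 0 < Real.sqrt t := Real.sqrt_pos.2 ht
  simp only [besselOp, besselLiouville, h4.deriv, fromLiouville, hs, hp, hp']
  field_simp
  ring

/-- `v` and `u` are a right and a left singular function of the Bessel operator in Liouville normal
form with type (i) boundary conditions, for the singular value `σ`. The boundary conditions are
imposed in the original variable. -/
structure IsSingularTriple (a σ : ℝ) (v u : ℝ → ℝ) : Prop where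
  differentiableOn_right : DifferentiableOn ℝ v (Ioo 0 1)
  differentiableOn_left : DifferentiableOn ℝ u (Ioo 0 1)
  memLp_right : MemLp v 2 (volume.restrict (Ioo 0 1))
  memLp_left : MemLp u 2 (volume.restrict (Ioo 0 1))
  boundary : TypeI a (fromLiouville v)
  nontrivial : ∃ x ∈ Ioo (0 : ℝ) 1, v x ≠ 0
  apply_right : ∀ x ∈ Ioo (0 : ℝ) 1, besselLiouville a v x = σ * u x
  apply_left : ∀ x ∈ Ioo (0 : ℝ) 1, besselLiouvilleAdj a u x = σ * v x

/-- The singular values of the Bessel operator in Liouville normal form with type (i) boundary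
conditions. -/
def besselSingularValues (a : ℝ) : Set ℝ :=
  {σ | 0 ≤ σ ∧ ∃ v u : ℝ → ℝ, IsSingularTriple a σ v u}

/-- The positive zeros of `j_a`. -/
def besselZeros (a : ℝ) : Set ℝ := {x | 0 < x ∧ besselJ a x = 0}

end JacobiBessel

end

/-! Part (1). Flipping `B₂₂` lists the angles in increasing order, so before the factor 1/h the
bidiagonal entries do not depend on n. Their squares are explicit rational functions of x = a + b +
2i in row i, and the squares of 1/2 ± (a + 1/2)/(2x) agree with them up to O(i⁻²). After taking
roots the error of the scaled entry is O(i⁻²)/h, which is O(h) once i ≥ ε/h.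

Part (2). For A = `jacobiHard`, the equation AᵀA q = z q is a three-term recurrence, solved up to
nonzero factors by the Jacobi polynomials P_i(h²z) = ₂F₁(-i, i+a+b+1; a+1; h²z): A sends the family
with parameters (a, b) to the one with (a+1, b), and Aᵀ sends it back (`jacobiPoly_sub_succ`,
`jacobiPoly_succ_eq`). Hence the squared singular values are exactly the zeros of P_n(h²z)
(`kthLeastSingularValue_bidiag`). As h ~ 1/(2n), the Mehler-Heine limit holds: P_n(h²z) tends to
₀F₁(; a+1; -z/4), locally uniformly on z ≥ 0 and with derivatives, by domination of Taylor
coefficients (`abs_scaledCoeff_le`). At z = x² this limit is j_a(x) up to a nonvanishing factor. Its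
positive zeros are simple, so the k-th zeros converge (`tendsto_kth_zero`).

On the continuous side, a singular pair solves a first order system whose Wronskians are constant.
The boundary condition at 0 makes the Wronskian with the regular solution vanish after
multiplication by σ, so v is a multiple of that solution near 1 unless the solution vanishes at 1.
The condition v(1) = 0 then forces ₀F₁(; a+1; -σ²/4) = 0 (`IsSingularTriple.hypLim_eq_zero`);
conversely the regular solution is a singular function at each such σ. -/

namespace JacobiBessel

/-! ### Power series dominated by an everywhere convergent one -/

/-- Tannery's theorem: Σ |c n k - c₀ k| Rᵏ tends to 0 by dominated convergence, and it bounds the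
difference of the two sums on all of [0, R]. -/
theorem tendstoUniformlyOn_tsum_mul_pow {c : ℕ → ℕ → ℝ} {c₀ g : ℕ → ℝ} {R : ℝ} (hR : 0 ≤ R)
    (hg : Summable fun k => g k * R ^ k) (hc : ∀ᶠ n in atTop, ∀ k, |c n k| ≤ g k)
    (hlim : ∀ k, Tendsto (fun n => c n k) atTop (𝓝 (c₀ k))) :
    TendstoUniformlyOn (fun n x => ∑' k, c n k * x ^ k) (fun x => ∑' k, c₀ k * x ^ k) atTop
      (Icc 0 R) := by
  have hc₀ : ∀ k, |c₀ k| ≤ g k := fun k =>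
    le_of_tendsto (hlim k).abs (hc.mono fun n hn => hn k)
  have key : Tendsto (fun n => ∑' k, |c n k - c₀ k| * R ^ k) atTop (𝓝 0) := by
    have h := tendsto_tsum_of_dominated_convergence (𝓕 := atTop)
      (f := fun n k => |c n k - c₀ k| * R ^ k) (g := fun _ => (0 : ℝ))
      (bound := fun k => 2 * (g k * R ^ k)) (hg.mul_left 2) ?_ ?_
    · simpa using h
    · intro k
      have : Tendsto (fun n => |c n k - c₀ k| * R ^ k) atTop (𝓝 (|c₀ k - c₀ k| * R ^ k)) :=
        ((hlim k).sub_const _).abs.mul_const _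
      simpa using this
    · filter_upwards [hc] with n hn k
      have : 0 ≤ R ^ k := by positivity
      rw [Real.norm_eq_abs, abs_mul, abs_abs, abs_of_nonneg this]
      have h1 := abs_sub (c n k) (c₀ k)
      nlinarith [hn k, hc₀ k]
  rw [Metric.tendstoUniformlyOn_iff]
  intro ε hε
  filter_upwards [hc, key.eventually_lt_const hε] with n hn hlt x hx
  have hb : ∀ {d : ℕ → ℝ}, (∀ k, |d k| ≤ g k) → Summable fun k => |d k| * R ^ k := fun hd =>
    Summable.of_nonneg_of_le (fun k => by positivity)
      (fun k => mul_le_mul_of_nonneg_right (hd k) (by positivity)) hg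
  have hle : ∀ (d : ℕ → ℝ) k, ‖d k * x ^ k‖ ≤ |d k| * R ^ k := fun d k => by
    rw [norm_mul, norm_pow, Real.norm_eq_abs, Real.norm_eq_abs, abs_of_nonneg hx.1]
    exact mul_le_mul_of_nonneg_left (pow_le_pow_left₀ hx.1 hx.2 k) (abs_nonneg _)
  have hs1 := Summable.of_norm_bounded (hb hn) (hle (c n))
  have hs0 := Summable.of_norm_bounded (hb hc₀) (hle c₀)
  have hd : Summable fun k => |c n k - c₀ k| * R ^ k :=
    Summable.of_nonneg_of_le (fun k => by positivity)
      (fun k => by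
        have := mul_le_mul_of_nonneg_right (abs_sub (c n k) (c₀ k))
          (by positivity : 0 ≤ R ^ k)
        rwa [add_mul] at this) ((hb hn).add (hb hc₀))
  rw [dist_comm, dist_eq_norm, ← hs1.tsum_sub hs0]
  refine lt_of_le_of_lt (tsum_of_norm_bounded hd.hasSum fun k => ?_) hlt
  rw [← sub_mul]
  exact hle (fun k => c n k - c₀ k) k

theorem hasDerivAt_tsum_mul_pow {c g : ℕ → ℝ} (hc : ∀ k, |c k| ≤ g k)
    (hg' : ∀ R : ℝ, 0 ≤ R → Summable fun k : ℕ => ((k : ℝ) + 1) * g (k + 1) * R ^ k) (x : ℝ) :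
    HasDerivAt (fun x => ∑' k, c k * x ^ k) (∑' k : ℕ, ((k : ℝ) + 1) * c (k + 1) * x ^ k) x := by
  set R : ℝ := |x| + 1
  have hR : 0 ≤ R := by positivity
  have hxR : x ∈ Metric.ball (0 : ℝ) R := by simp [R]
  have h0R : (0 : ℝ) ∈ Metric.ball (0 : ℝ) R := Metric.mem_ball_self (by positivity)
  have hu : Summable fun k : ℕ => (k : ℝ) * g k * R ^ (k - 1) := by
    rw [← summable_nat_add_iff 1]
    simpa using hg' R hR
  have h := hasDerivAt_tsum_of_isPreconnected (g := fun k x => c k * x ^ k)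
    (g' := fun k x => c k * (k * x ^ (k - 1))) hu Metric.isOpen_ball
    (convex_ball (0 : ℝ) R).isPreconnected
    (fun k y _ => (hasDerivAt_pow k y).const_mul (c k)) ?_ h0R ?_ hxR
  · refine h.congr_deriv ?_
    have hs : Summable fun k : ℕ => c k * (k * x ^ (k - 1)) := by
      refine Summable.of_norm_bounded hu fun k => ?_
      rw [norm_mul, norm_mul, norm_pow, Real.norm_eq_abs, Real.norm_natCast, Real.norm_eq_abs]
      have : |x| ^ (k - 1) ≤ R ^ (k - 1) := pow_le_pow_left₀ (abs_nonneg _) (by simp [R]) _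
      calc |c k| * (k * |x| ^ (k - 1)) ≤ g k * (k * R ^ (k - 1)) := by
            gcongr
            · exact (abs_nonneg _).trans (hc k)
            · exact hc k
        _ = _ := by ring
    rw [hs.tsum_eq_zero_add]
    simp only [Nat.cast_zero, zero_mul, mul_zero, zero_add, Nat.cast_add, Nat.cast_one,
      Nat.add_sub_cancel]
    exact tsum_congr fun k => by ring
  · intro k y hy
    have hy' : |y| ≤ R := by simpa using (Metric.mem_ball.1 hy).le
    rw [norm_mul, norm_mul, norm_pow, Real.norm_eq_abs, Real.norm_natCast, Real.norm_eq_abs]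
    have : |y| ^ (k - 1) ≤ R ^ (k - 1) := pow_le_pow_left₀ (abs_nonneg _) hy' _
    calc |c k| * (k * |y| ^ (k - 1)) ≤ g k * (k * R ^ (k - 1)) := by
          gcongr
          · exact (abs_nonneg _).trans (hc k)
          · exact hc k
      _ = _ := by ring
  · refine summable_of_ne_finset_zero (s := {0}) fun k hk => ?_
    simp only [Finset.mem_singleton] at hk
    simp [hk]

/-! ### The confluent hypergeometric limit function -/

/-- The coefficients `1 / ((a + 1)ₖ k!)`. -/
noncomputable def limCoeff (a : ℝ) (k : ℕ) : ℝ :=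
  ∏ j ∈ Finset.range k, ((a + 1 + j) * (j + 1))⁻¹

/-- The confluent hypergeometric limit function `₀F₁(; a + 1; z)`. -/
noncomputable def hypLim (a z : ℝ) : ℝ := ∑' k, limCoeff a k * z ^ k

variable {a : ℝ}

theorem limCoeff_succ (a : ℝ) (k : ℕ) :
    limCoeff a (k + 1) = limCoeff a k * ((a + 1 + k) * (k + 1))⁻¹ :=
  Finset.prod_range_succ _ _

theorem limCoeff_pos (ha : -1 < a) (k : ℕ) : 0 < limCoeff a k :=
  Finset.prod_pos fun j _ => by
    have : (0 : ℝ) < a + 1 + j := by linarith [(Nat.cast_nonneg j : (0 : ℝ) ≤ j)]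
    positivity

/-- Coefficient form of d/dz ₀F₁(; a+1; z) = ₀F₁(; a+2; z) / (a+1). -/
theorem limCoeff_succ_eq (a : ℝ) (k : ℕ) :
    ((k : ℝ) + 1) * limCoeff a (k + 1) = (a + 1)⁻¹ * limCoeff (a + 1) k := by
  induction k with
  | zero => simp [limCoeff]
  | succ k ih =>
    have hk : (k : ℝ) + 1 ≠ 0 := by positivity
    have hk' : (k : ℝ) + 1 + 1 ≠ 0 := by positivity
    rw [limCoeff_succ (a + 1) k, ← mul_assoc, ← ih, limCoeff_succ a (k + 1)]
    push_cast
    rw [mul_inv, mul_inv, show a + 1 + ((k : ℝ) + 1) = a + 1 + 1 + k by ring]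
    field_simp

theorem limCoeff_shift (ha : -1 < a) (k : ℕ) :
    (a + 1) * limCoeff a k = (a + 1 + k) * limCoeff (a + 1) k := by
  have h : ∀ k : ℕ, (0 : ℝ) < a + 1 + k := fun k => by
    linarith [(Nat.cast_nonneg k : (0 : ℝ) ≤ k)]
  induction k with
  | zero => simp [limCoeff]
  | succ k ih =>
    have h1 := (h k).ne'
    have h2 : a + 1 + 1 + (k : ℝ) ≠ 0 := by linarith [h k]
    rw [limCoeff_succ, limCoeff_succ, ← mul_assoc, ih]
    push_cast
    field_simp
    ring

theorem summable_limCoeff (ha : -1 < a) (R : ℝ) : Summable fun k => limCoeff a k * R ^ k := by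
  refine summable_of_ratio_norm_eventually_le (r := 1 / 2) (by norm_num) ?_
  have hlim : ∀ᶠ k : ℕ in atTop, 2 * |R| ≤ (k : ℝ) :=
    tendsto_natCast_atTop_atTop.eventually_ge_atTop _
  filter_upwards [hlim, eventually_ge_atTop 1] with k hk hk1
  have hk1' : (1 : ℝ) ≤ k := by exact_mod_cast hk1
  have h1 : 0 < (a + 1 + k) * ((k : ℝ) + 1) := by
    have : 0 < a + 1 + k := by linarith
    positivity
  have h2 : |R| * ((a + 1 + k) * ((k : ℝ) + 1))⁻¹ ≤ 1 / 2 := by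
    rw [← div_eq_mul_inv, div_le_iff₀ h1]
    nlinarith [abs_nonneg R]
  rw [limCoeff_succ, pow_succ, norm_mul, norm_mul, norm_mul, norm_mul, norm_pow, Real.norm_eq_abs,
    Real.norm_eq_abs, Real.norm_eq_abs, abs_of_pos (inv_pos.2 h1)]
  calc |limCoeff a k| * ((a + 1 + k) * ((k : ℝ) + 1))⁻¹ * (|R| ^ k * |R|)
      = (|R| * ((a + 1 + k) * ((k : ℝ) + 1))⁻¹) * (|limCoeff a k| * |R| ^ k) := by ring
    _ ≤ _ := by gcongr

theorem summable_limCoeff_deriv (ha : -1 < a) (R : ℝ) :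
    Summable fun k : ℕ => ((k : ℝ) + 1) * limCoeff a (k + 1) * R ^ k := by
  simp_rw [limCoeff_succ_eq, mul_assoc]
  exact (summable_limCoeff (by linarith) R).mul_left _

theorem hypLim_zero (a : ℝ) : hypLim a 0 = 1 := by
  rw [hypLim, tsum_eq_single 0 fun k hk => by simp [hk]]
  simp [limCoeff]

theorem hasDerivAt_hypLim (ha : -1 < a) (z : ℝ) :
    HasDerivAt (hypLim a) (hypLim (a + 1) z / (a + 1)) z := by
  have h := hasDerivAt_tsum_mul_pow (c := limCoeff a) (g := limCoeff a)
    (fun k => (abs_of_pos (limCoeff_pos ha k)).le)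
    (fun R _ => summable_limCoeff_deriv ha R) z
  refine h.congr_deriv ?_
  simp_rw [limCoeff_succ_eq, mul_assoc]
  rw [tsum_mul_left, div_eq_inv_mul, hypLim]

theorem continuous_hypLim (ha : -1 < a) : Continuous (hypLim a) :=
  continuous_iff_continuousAt.2 fun z => (hasDerivAt_hypLim ha z).continuousAt

/-- The contiguous relation of `₀F₁`. -/
theorem hypLim_contiguous (ha : -1 < a) (z : ℝ) :
    (a + 1) * hypLim a z =
      (a + 1) * hypLim (a + 1) z + z * (hypLim (a + 1 + 1) z / (a + 1 + 1)) := by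
  have ha1 : -1 < a + 1 := by linarith
  have hs := summable_limCoeff ha1 z
  have hsd := summable_limCoeff_deriv ha1 z
  have h1 : hypLim (a + 1 + 1) z / (a + 1 + 1) =
      ∑' k : ℕ, ((k : ℝ) + 1) * limCoeff (a + 1) (k + 1) * z ^ k := by
    simp_rw [limCoeff_succ_eq, mul_assoc]
    rw [tsum_mul_left, div_eq_inv_mul, hypLim]
  have hs2 : Summable fun k : ℕ => (k : ℝ) * limCoeff (a + 1) k * z ^ k := by
    rw [← summable_nat_add_iff 1]
    refine (hsd.mul_left z).congr fun k => ?_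
    push_cast
    ring
  have h2 : z * (hypLim (a + 1 + 1) z / (a + 1 + 1)) =
      ∑' k : ℕ, (k : ℝ) * limCoeff (a + 1) k * z ^ k := by
    rw [h1, hs2.tsum_eq_zero_add, ← tsum_mul_left]
    simp only [Nat.cast_zero, zero_mul, zero_add]
    refine tsum_congr fun k => ?_
    push_cast
    ring
  rw [h2, hypLim, hypLim, ← tsum_mul_left, ← tsum_mul_left, ← (hs.mul_left _).tsum_add hs2]
  refine tsum_congr fun k => ?_
  rw [← mul_assoc, limCoeff_shift ha]
  ring

/-- Links the Bessel series to ₀F₁ through Γ(k+a+1) = (a+1)ₖ Γ(a+1). -/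
theorem Gamma_mul_limCoeff (ha : -1 < a) (k : ℕ) :
    (k.factorial * Real.Gamma (k + a + 1) : ℝ)⁻¹ = (Real.Gamma (a + 1))⁻¹ * limCoeff a k := by
  induction k with
  | zero => simp [limCoeff]
  | succ k ih =>
    have h : (0 : ℝ) < k + a + 1 := by linarith [(Nat.cast_nonneg k : (0 : ℝ) ≤ k)]
    rw [limCoeff_succ, ← mul_assoc, ← ih, Nat.factorial_succ]
    push_cast
    rw [show (k : ℝ) + 1 + a + 1 = k + a + 1 + 1 by ring, Real.Gamma_add_one h.ne',
      ← mul_inv, show a + 1 + (k : ℝ) = k + a + 1 by ring]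
    congr 1
    ring

theorem besselJ_eq (ha : -1 < a) {x : ℝ} (hx : 0 < x) :
    besselJ a x = (x / 2) ^ a * (Real.Gamma (a + 1))⁻¹ * hypLim a (-(x ^ 2 / 4)) := by
  rw [besselJ, hypLim, ← tsum_mul_left]
  refine tsum_congr fun k => ?_
  have h2 : (x / 2) ^ (2 * (k : ℝ) + a) = (x / 2) ^ a * (x ^ 2 / 4) ^ k := by
    rw [Real.rpow_add (by positivity), mul_comm, show (2 * (k : ℝ)) = ((2 * k : ℕ) : ℝ) by simp,
      Real.rpow_natCast, pow_mul]
    congr 2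
    ring
  rw [h2, div_eq_mul_inv, Gamma_mul_limCoeff ha, neg_pow (x ^ 2 / 4)]
  ring

theorem besselJ_eq_zero_iff (ha : -1 < a) {x : ℝ} (hx : 0 < x) :
    besselJ a x = 0 ↔ hypLim a (-(x ^ 2 / 4)) = 0 := by
  have h1 : (x / 2) ^ a ≠ 0 := (Real.rpow_pos_of_pos (by positivity) _).ne'
  have h2 : (Real.Gamma (a + 1))⁻¹ ≠ 0 := inv_ne_zero (Real.Gamma_pos_of_pos (by linarith)).ne'
  rw [besselJ_eq ha hx]
  simp [h1, h2]

end JacobiBessel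

/-! ### The continuous side: singular values of the Bessel operator are the positive zeros of j_a.
-/

namespace JacobiBessel

/-! ### Functions on an open interval with a signed derivative -/

theorem monotoneOn_Ioo_of_hasDerivAt {f f' : ℝ → ℝ} {p q : ℝ}
    (h : ∀ x ∈ Ioo p q, HasDerivAt f (f' x) x) (h0 : ∀ x ∈ Ioo p q, 0 ≤ f' x) :
    MonotoneOn f (Ioo p q) :=
  monotoneOn_of_deriv_nonneg (convex_Ioo p q)
    (fun x hx => (h x hx).continuousAt.continuousWithinAt)
    (fun x hx => (h x (interior_subset hx)).differentiableAt.differentiableWithinAt)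
    (fun x hx => by rw [(h x (interior_subset hx)).deriv]; exact h0 x (interior_subset hx))

theorem antitoneOn_Ioo_of_hasDerivAt {f f' : ℝ → ℝ} {p q : ℝ}
    (h : ∀ x ∈ Ioo p q, HasDerivAt f (f' x) x) (h0 : ∀ x ∈ Ioo p q, f' x ≤ 0) :
    AntitoneOn f (Ioo p q) :=
  antitoneOn_of_deriv_nonpos (convex_Ioo p q)
    (fun x hx => (h x hx).continuousAt.continuousWithinAt)
    (fun x hx => (h x (interior_subset hx)).differentiableAt.differentiableWithinAt)
    (fun x hx => by rw [(h x (interior_subset hx)).deriv]; exact h0 x (interior_subset hx))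

theorem eq_of_hasDerivAt_zero {f : ℝ → ℝ} {p q x y : ℝ}
    (h : ∀ x ∈ Ioo p q, HasDerivAt f 0 x) (hx : x ∈ Ioo p q) (hy : y ∈ Ioo p q) : f x = f y := by
  have h1 := monotoneOn_Ioo_of_hasDerivAt h fun _ _ => le_rfl
  have h2 := antitoneOn_Ioo_of_hasDerivAt h fun _ _ => le_rfl
  rcases le_total x y with hxy | hxy
  · exact le_antisymm (h1 hx hy hxy) (h2 hx hy hxy)
  · exact le_antisymm (h2 hy hx hxy) (h1 hy hx hxy)

/-! ### The first order Bessel system -/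

/-- `v' = (c / x) v - s u` and `u' = s v - (c / x) u` on `(0, L)`. -/
structure BesselSystem (c s L : ℝ) (v u : ℝ → ℝ) : Prop where
  right : ∀ x ∈ Ioo 0 L, HasDerivAt v (c / x * v x - s * u x) x
  left : ∀ x ∈ Ioo 0 L, HasDerivAt u (s * v x - c / x * u x) x

namespace BesselSystem

variable {c s L : ℝ} {v u V U : ℝ → ℝ}

/-- Uniqueness through an energy. E = v² + u² has E' = (2c/x)(v² - u²), so x^(2|c|) E increases and
x^(-2|c|) E decreases. A zero of E at x₀ therefore spreads to the left by the first and to the right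
by the second. -/
theorem eq_zero (h : BesselSystem c s L v u) {x₀ : ℝ} (hx₀ : x₀ ∈ Ioo 0 L) (hv : v x₀ = 0)
    (hu : u x₀ = 0) {x : ℝ} (hx : x ∈ Ioo 0 L) : v x = 0 ∧ u x = 0 := by
  have hE : ∀ p : ℝ, ∀ x ∈ Ioo 0 L, HasDerivAt (fun x => (v x ^ 2 + u x ^ 2) * x ^ p)
      (x ^ (p - 1) * ((p + 2 * c) * v x ^ 2 + (p - 2 * c) * u x ^ 2)) x := by
    intro p x hx
    have h1 := (((h.right x hx).pow 2).add ((h.left x hx).pow 2)).mul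
      (Real.hasDerivAt_rpow_const (p := p) (Or.inl hx.1.ne'))
    refine h1.congr_deriv ?_
    have hx0 := hx.1.ne'
    simp only [Real.rpow_sub_one hx0, Pi.add_apply, Pi.pow_apply]
    field_simp
    ring
  have hpos : ∀ p : ℝ, ∀ x ∈ Ioo 0 L, 0 ≤ x ^ p := fun p x hx => Real.rpow_nonneg hx.1.le p
  have key : v x ^ 2 + u x ^ 2 ≤ 0 := by
    have hc1 := le_abs_self c
    have hc2 := neg_abs_le c
    rcases le_total x x₀ with hle | hle
    · have hm := monotoneOn_Ioo_of_hasDerivAt (hE (2 * |c|)) fun y hy =>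
        mul_nonneg (hpos _ y hy) (by
          have h1 : 0 ≤ 2 * |c| + 2 * c := by linarith
          have h2 : 0 ≤ 2 * |c| - 2 * c := by linarith
          positivity)
      have := hm hx hx₀ hle
      simp only [hv, hu] at this
      have hp : 0 < x ^ (2 * |c|) := Real.rpow_pos_of_pos hx.1 _
      exact nonpos_of_mul_nonpos_left (by simpa using this) hp
    · have hm := antitoneOn_Ioo_of_hasDerivAt (hE (-(2 * |c|))) fun y hy =>
        mul_nonpos_of_nonneg_of_nonpos (hpos _ y hy) (by
          have h1 : 0 ≤ 2 * |c| + 2 * c := by linarith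
          have h2 : 0 ≤ 2 * |c| - 2 * c := by linarith
          nlinarith [mul_nonneg h1 (sq_nonneg (u y)), mul_nonneg h2 (sq_nonneg (v y))])
      have := hm hx₀ hx hle
      simp only [hv, hu] at this
      have hp : 0 < x ^ (-(2 * |c|)) := Real.rpow_pos_of_pos hx.1 _
      exact nonpos_of_mul_nonpos_left (by simpa using this) hp
  constructor
  · nlinarith [sq_nonneg (v x), sq_nonneg (u x)]
  · nlinarith [sq_nonneg (v x), sq_nonneg (u x)]

/-- The coefficient matrix of the system has trace zero. -/
theorem wronskian_eq (h : BesselSystem c s L v u) (H : BesselSystem c s L V U) {x y : ℝ}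
    (hx : x ∈ Ioo 0 L) (hy : y ∈ Ioo 0 L) : v x * U x - u x * V x = v y * U y - u y * V y := by
  refine eq_of_hasDerivAt_zero (f := fun x => v x * U x - u x * V x) (fun t ht => ?_) hx hy
  refine (((h.right t ht).mul (H.left t ht)).sub ((h.left t ht).mul (H.right t ht))).congr_deriv ?_
  ring

theorem hasDerivAt_div (h : BesselSystem c s L v u) (H : BesselSystem c s L V U) {x : ℝ}
    (hx : x ∈ Ioo 0 L) (hV : V x ≠ 0) :
    HasDerivAt (fun x => v x / V x) (s * (v x * U x - u x * V x) / V x ^ 2) x := by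
  refine ((h.right x hx).div (H.right x hx) hV).congr_deriv ?_
  congr 1
  ring

end BesselSystem

variable {a : ℝ}

/-- The solution of the Bessel system that is regular at `0`, right component. -/
noncomputable def regRight (a s x : ℝ) : ℝ := x ^ (a + 1 / 2) * hypLim a (-((s * x) ^ 2 / 4))

/-- The solution of the Bessel system that is regular at `0`, left component. -/
noncomputable def regLeft (a s x : ℝ) : ℝ :=
  x ^ (a + 3 / 2) * (s / (2 * (a + 1)) * hypLim (a + 1) (-((s * x) ^ 2 / 4)))

theorem continuous_hypLim_comp (ha : -1 < a) (s : ℝ) :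
    Continuous fun x => hypLim a (-((s * x) ^ 2 / 4)) :=
  (continuous_hypLim ha).comp (by fun_prop)

theorem hasDerivAt_hypLim_comp (ha : -1 < a) (s x : ℝ) :
    HasDerivAt (fun x => hypLim a (-((s * x) ^ 2 / 4)))
      (hypLim (a + 1) (-((s * x) ^ 2 / 4)) / (a + 1) * (-(s ^ 2 * x / 2))) x := by
  have h1 : HasDerivAt (fun x : ℝ => -((s * x) ^ 2 / 4)) (-(s ^ 2 * x / 2)) x := by
    refine (((((hasDerivAt_id x).const_mul s).pow 2).div_const 4).neg).congr_deriv ?_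
    simp
    ring
  exact (hasDerivAt_hypLim ha _).comp x h1

/-- The first equation is the derivative formula of ₀F₁. The second also needs the contiguous
relation, which rewrites ₀F₁(; a+1) through the parameters a+2 and a+3. -/
theorem besselSystem_reg (ha : -1 < a) (s L : ℝ) :
    BesselSystem (a + 1 / 2) s L (regRight a s) (regLeft a s) where
  right x hx := by
    have hx0 := hx.1.ne'
    have h := (Real.hasDerivAt_rpow_const (p := a + 1 / 2) (Or.inl hx0)).mul
      (hasDerivAt_hypLim_comp ha s x)
    refine h.congr_deriv ?_
    have ha1 : a + 1 ≠ 0 := by linarith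
    have e : x ^ (a + 3 / 2) = x ^ (a + 1 / 2) * x := by
      rw [← Real.rpow_add_one hx0]; congr 1; ring
    simp only [regRight, regLeft, e, Real.rpow_sub_one hx0]
    field_simp
    ring
  left x hx := by
    have hx0 := hx.1.ne'
    have h := (Real.hasDerivAt_rpow_const (p := a + 3 / 2) (Or.inl hx0)).mul
      ((hasDerivAt_hypLim_comp (a := a + 1) (by linarith) s x).const_mul (s / (2 * (a + 1))))
    refine h.congr_deriv ?_
    have ha1 : a + 1 ≠ 0 := by linarith
    have ha2 : a + 1 + 1 ≠ 0 := by linarith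
    have e : x ^ (a + 3 / 2) = x ^ (a + 1 / 2) * x := by
      rw [← Real.rpow_add_one hx0]; congr 1; ring
    have hc := hypLim_contiguous ha (-((s * x) ^ 2 / 4))
    have hc' : hypLim a (-((s * x) ^ 2 / 4)) = hypLim (a + 1) (-((s * x) ^ 2 / 4)) +
        (-((s * x) ^ 2 / 4)) * (hypLim (a + 1 + 1) (-((s * x) ^ 2 / 4)) / (a + 1 + 1)) / (a + 1) := by
      field_simp
      field_simp at hc
      linarith
    simp only [regRight, regLeft, e, Real.rpow_sub_one hx0, hc']
    field_simp
    ring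

/-- The zeros of the regular solution are simple. -/
theorem hypLim_succ_ne_zero (ha : -1 < a) {x : ℝ} (hx : 0 < x) (h : hypLim a (-(x ^ 2 / 4)) = 0) :
    hypLim (a + 1) (-(x ^ 2 / 4)) ≠ 0 := by
  intro h'
  -- If both functions vanished at x, both components of the regular solution would, and uniqueness
  -- would make it zero on (0, x). This contradicts `hypLim a` tending to 1 at 0.
  have hz : ∀ t ∈ Ioo 0 x, hypLim a (-((1 * t) ^ 2 / 4)) = 0 := fun t ht => by
    have := ((besselSystem_reg ha 1 (x + 1)).eq_zero (x₀ := x) ⟨hx, by linarith⟩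
      (by simp [regRight, h]) (by simp [regLeft, h']) (x := t) ⟨ht.1, by linarith [ht.2]⟩).1
    rw [regRight] at this
    exact (mul_eq_zero.1 this).resolve_left (Real.rpow_pos_of_pos ht.1 _).ne'
  have hlim : Tendsto (fun t => hypLim a (-((1 * t) ^ 2 / 4))) (𝓝[>] 0) (𝓝 1) := by
    have := (continuous_hypLim_comp ha 1).tendsto 0
    simp only [mul_zero, ne_eq, OfNat.ofNat_ne_zero, not_false_eq_true, zero_pow, zero_div,
      neg_zero, hypLim_zero] at this
    exact this.mono_left nhdsWithin_le_nhds
  have hlim0 : Tendsto (fun t => hypLim a (-((1 * t) ^ 2 / 4))) (𝓝[>] 0) (𝓝 0) :=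
    tendsto_const_nhds.congr' (by
      filter_upwards [Ioo_mem_nhdsGT hx] with t ht
      exact (hz t ht).symm)
  exact one_ne_zero (tendsto_nhds_unique hlim hlim0)

/-- The zeros of the regular solution are unbounded. -/
theorem exists_hypLim_eq_zero (ha : -1 < a) (R : ℝ) :
    ∃ x, R < x ∧ 0 < x ∧ hypLim a (-(x ^ 2 / 4)) = 0 := by
  by_contra! hne
  set c := a + 1 / 2
  -- Beyond 2|c| the coefficient 2c/x of the Riccati equation below is at most 1 in absolute value.
  set X : ℝ := max R (2 * |c| + 1)
  have hXR : R ≤ X := le_max_left _ _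
  have hXc : 2 * |c| + 1 ≤ X := le_max_right _ _
  have hc0 := abs_nonneg c
  have hsys := besselSystem_reg ha 1 (X + 10)
  have hV : ∀ x ∈ Ioo X (X + 10), regRight a 1 x ≠ 0 := fun x hx => by
    have hx0 : 0 < x := by linarith [hx.1]
    have := hne x (by linarith [hx.1]) hx0
    rw [regRight, one_mul]
    exact mul_ne_zero (Real.rpow_pos_of_pos hx0 _).ne' this
  set r : ℝ → ℝ := fun x => regLeft a 1 x / regRight a 1 x
  have hr : ∀ x ∈ Ioo X (X + 10), HasDerivAt r (1 - 2 * (c / x) * r x + r x ^ 2) x := by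
    intro x hx
    have hx' : x ∈ Ioo 0 (X + 10) := ⟨by linarith [hx.1], hx.2⟩
    have hx0 := hx'.1.ne'
    refine ((hsys.left x hx').div (hsys.right x hx') (hV x hx)).congr_deriv ?_
    have := hV x hx
    simp only [r]
    field_simp
    ring
  -- Prüfer angle: with r = u/v, arctan r has derivative at least (1 - |r| + r²)/(1 + r²) ≥ 1/2.
  -- Without zeros of v it would gain 4 > π between X + 1 and X + 9, more than the range of arctan.
  have hA : ∀ x ∈ Ioo X (X + 10), HasDerivAt (fun x => Real.arctan (r x) - x / 2)
      (1 / (1 + r x ^ 2) * (1 - 2 * (c / x) * r x + r x ^ 2) - 1 / 2) x := fun x hx =>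
    (hr x hx).arctan.sub ((hasDerivAt_id x).div_const 2)
  have hm := monotoneOn_Ioo_of_hasDerivAt hA fun x hx => by
    have hx0 : 0 < x := by linarith [hx.1]
    have hcx : |2 * (c / x)| ≤ 1 := by
      rw [abs_mul, abs_div, abs_two, abs_of_pos hx0, ← mul_div_assoc, div_le_one hx0]
      linarith [hx.1]
    have h1 : 0 < 1 + r x ^ 2 := by positivity
    have h2 : 2 * (c / x) * r x ≤ |r x| := by
      refine (le_abs_self _).trans ?_
      rw [abs_mul]
      nlinarith [abs_nonneg (r x)]
    rw [sub_nonneg, one_div_mul_eq_div, le_div_iff₀ h1]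
    nlinarith [sq_nonneg (|r x| - 1), sq_abs (r x)]
  have := hm (a := X + 1) (b := X + 9) ⟨by linarith, by linarith⟩ ⟨by linarith, by linarith⟩
    (by linarith)
  have h1 := Real.arctan_lt_pi_div_two (r (X + 9))
  have h2 := Real.neg_pi_div_two_lt_arctan (r (X + 1))
  have h3 := Real.pi_lt_four
  simp only at this
  linarith

/-! ### Singular triples -/

theorem besselOp_fromLiouville (a : ℝ) {v : ℝ → ℝ} {t : ℝ} (ht : 0 < t)
    (hv : DifferentiableAt ℝ v t) :
    besselOp a (fromLiouville v) (t ^ 2) = besselLiouville a v t / Real.sqrt t := by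
  rw [besselLiouville_eq a v t ht hv, mul_div_cancel_left₀ _ (Real.sqrt_pos.2 ht).ne']

theorem tendsto_sq_nhdsGT_zero : Tendsto (fun t : ℝ => t ^ 2) (𝓝[>] 0) (𝓝[>] 0) := by
  refine tendsto_nhdsWithin_iff.2 ⟨?_, ?_⟩
  · have := (continuous_pow 2 (M := ℝ)).tendsto 0
    simp only [ne_eq, OfNat.ofNat_ne_zero, not_false_eq_true, zero_pow] at this
    exact this.mono_left nhdsWithin_le_nhds
  · filter_upwards [self_mem_nhdsWithin] with t ht
    exact pow_pos (mem_Ioi.1 ht) 2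

theorem tendsto_rpow_nhdsGT_zero {p : ℝ} (hp : 0 < p) :
    Tendsto (fun t : ℝ => t ^ p) (𝓝[>] 0) (𝓝 0) := by
  have := (Real.continuousAt_rpow_const 0 p (Or.inr hp.le)).tendsto
  rw [Real.zero_rpow hp.ne'] at this
  exact this.mono_left nhdsWithin_le_nhds

namespace IsSingularTriple

variable {s : ℝ} {v u : ℝ → ℝ}

theorem besselSystem (h : IsSingularTriple a s v u) : BesselSystem (a + 1 / 2) s 1 v u where
  right x hx := by
    have hd := (h.differentiableOn_right.differentiableAt (Ioo_mem_nhds hx.1 hx.2)).hasDerivAt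
    have := h.apply_right x hx
    rw [besselLiouville] at this
    refine hd.congr_deriv ?_
    rw [div_eq_mul_one_div]
    linarith
  left x hx := by
    have hd := (h.differentiableOn_left.differentiableAt (Ioo_mem_nhds hx.1 hx.2)).hasDerivAt
    have := h.apply_left x hx
    rw [besselLiouvilleAdj] at this
    refine hd.congr_deriv ?_
    rw [div_eq_mul_one_div]
    linarith

theorem tendsto_right_one (h : IsSingularTriple a s v u) : Tendsto v (𝓝[<] 1) (𝓝 0) := by
  have hsq : Tendsto (fun t : ℝ => t ^ 2) (𝓝[<] 1) (𝓝[<] 1) := by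
    refine tendsto_nhdsWithin_iff.2 ⟨?_, ?_⟩
    · have := (continuous_pow 2 (M := ℝ)).tendsto 1
      rw [one_pow] at this
      exact this.mono_left nhdsWithin_le_nhds
    · filter_upwards [Ioo_mem_nhdsLT (zero_lt_one' ℝ)] with t ht
      have h1 := ht.1
      have h2 := ht.2
      simp only [mem_Iio]
      nlinarith
  have hs : Tendsto (fun t : ℝ => Real.sqrt t) (𝓝[<] 1) (𝓝 1) := by
    have := Real.continuous_sqrt.tendsto 1
    rw [Real.sqrt_one] at this
    exact this.mono_left nhdsWithin_le_nhds
  have := hs.mul (h.boundary.1.comp hsq)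
  rw [mul_zero] at this
  refine this.congr' ?_
  filter_upwards [Ioo_mem_nhdsLT (zero_lt_one' ℝ)] with t ht
  have hst : 0 < Real.sqrt t := Real.sqrt_pos.2 ht.1
  have hp : (t ^ 2) ^ (-(1 / 4 : ℝ)) = (Real.sqrt t)⁻¹ := by
    rw [← Real.rpow_natCast t 2, ← Real.rpow_mul ht.1.le, Real.sqrt_eq_rpow,
      ← Real.rpow_neg ht.1.le]
    norm_num
  simp only [Function.comp, fromLiouville, hp, Real.sqrt_sq ht.1.le]
  field_simp

/-- In Liouville variables the condition at 0 bears on the left function: `besselOp` of w at t² is s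
u(t)/√t. -/
theorem tendsto_left_zero (h : IsSingularTriple a s v u) :
    Tendsto (fun t => s * u t / Real.sqrt t) (𝓝[>] 0) (𝓝 0) := by
  refine (h.boundary.2.comp tendsto_sq_nhdsGT_zero).congr' ?_
  filter_upwards [Ioo_mem_nhdsGT (zero_lt_one' ℝ)] with t ht
  rw [Function.comp, besselOp_fromLiouville a ht.1
    (h.differentiableOn_right.differentiableAt (Ioo_mem_nhds ht.1 ht.2)), h.apply_right t ht]

/-- Near `0`, the right singular function is at most of the order of `x ^ (-1 / 2)`. -/
theorem tendsto_rpow_mul_right (ha : -1 < a) (h : IsSingularTriple a s v u) :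
    Tendsto (fun t => t ^ (a + 3 / 2) * v t) (𝓝[>] 0) (𝓝 0) := by
  have hev : ∀ᶠ t in 𝓝[>] (0 : ℝ), |s * u t / Real.sqrt t| < 1 := by
    have := h.tendsto_left_zero.abs
    rw [abs_zero] at this
    exact this.eventually_lt_const zero_lt_one
  obtain ⟨δ, hδ0, hδ⟩ := (mem_nhdsGT_iff_exists_Ioo_subset).1 hev
  set ρ := min δ 1
  have hρ0 : 0 < ρ := lt_min hδ0 one_pos
  -- Variation of constants: g = t^(-(a+1/2)) v has g' = -t^(-(a+1/2)) s u, which is bounded by -G'.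
  -- Comparing g with ±G gives |g| ≤ const + G near 0.
  set G : ℝ → ℝ := fun t => t ^ (-(a + 1)) / (a + 1)
  set g : ℝ → ℝ := fun t => t ^ (-(a + 1 / 2)) * v t
  have ha1 : a + 1 ≠ 0 := by linarith
  have hG : ∀ t ∈ Ioo 0 ρ, HasDerivAt G (-t ^ (-(a + 1) - 1)) t := fun t ht => by
    refine ((Real.hasDerivAt_rpow_const (Or.inl ht.1.ne')).div_const _).congr_deriv ?_
    field_simp
  have hg : ∀ t ∈ Ioo 0 ρ, HasDerivAt g (-(t ^ (-(a + 1 / 2)) * (s * u t))) t := fun t ht => by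
    refine ((Real.hasDerivAt_rpow_const (Or.inl ht.1.ne')).mul
      (h.besselSystem.right t ⟨ht.1, ht.2.trans_le (min_le_right _ _)⟩)).congr_deriv ?_
    rw [Real.rpow_sub_one ht.1.ne']
    ring
  have hb : ∀ t ∈ Ioo 0 ρ, |t ^ (-(a + 1 / 2)) * (s * u t)| ≤ t ^ (-(a + 1) - 1) := by
    intro t ht
    have h1 : |s * u t| ≤ Real.sqrt t := by
      have : |s * u t / Real.sqrt t| < 1 := hδ ⟨ht.1, ht.2.trans_le (min_le_left _ _)⟩
      rw [abs_div, abs_of_pos (Real.sqrt_pos.2 ht.1), div_lt_one (Real.sqrt_pos.2 ht.1)] at this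
      exact this.le
    rw [abs_mul, abs_of_pos (Real.rpow_pos_of_pos ht.1 _)]
    calc t ^ (-(a + 1 / 2)) * |s * u t| ≤ t ^ (-(a + 1 / 2)) * t ^ (1 / 2 : ℝ) := by
          rw [← Real.sqrt_eq_rpow]
          exact mul_le_mul_of_nonneg_left h1 (Real.rpow_pos_of_pos ht.1 _).le
      _ = t ^ (-a) := by rw [← Real.rpow_add ht.1]; congr 1; ring
      -- The exponent -a is lowered to -a-2, so that the antiderivative is a negative power for
      -- every a > -1, with no logarithmic case at a = 1.
      _ ≤ _ := Real.rpow_le_rpow_of_exponent_ge ht.1 (ht.2.le.trans (min_le_right _ _))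
          (by linarith)
  have hm := monotoneOn_Ioo_of_hasDerivAt (fun t ht => (hg t ht).sub (hG t ht)) fun t ht => by
    have := (abs_le.1 (hb t ht)).2
    linarith
  have hm' := antitoneOn_Ioo_of_hasDerivAt (fun t ht => (hg t ht).add (hG t ht)) fun t ht => by
    have := (abs_le.1 (hb t ht)).1
    linarith
  have hx₀ : ρ / 2 ∈ Ioo 0 ρ := ⟨by linarith, by linarith⟩
  have hbound : ∀ᶠ t in 𝓝[>] (0 : ℝ),
      ‖t ^ (a + 3 / 2) * v t‖ ≤ t ^ (2 * (a + 1)) * |g (ρ / 2)| + t ^ (a + 1) / (a + 1) := by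
    filter_upwards [Ioo_mem_nhdsGT hx₀.1] with t ht
    have ht' : t ∈ Ioo 0 ρ := ⟨ht.1, ht.2.trans hx₀.2⟩
    have h1 := hm ht' hx₀ ht.2.le
    have h2 := hm' ht' hx₀ ht.2.le
    have hGp : 0 < G (ρ / 2) := div_pos (Real.rpow_pos_of_pos hx₀.1 _) (by linarith)
    simp only [Pi.sub_apply, Pi.add_apply] at h1 h2
    have h3 : |g t| ≤ |g (ρ / 2)| + G t := by
      rw [abs_le]
      constructor <;> linarith [le_abs_self (g (ρ / 2)), neg_abs_le (g (ρ / 2))]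
    have e1 : t ^ (a + 3 / 2) * v t = t ^ (2 * (a + 1)) * g t := by
      simp only [g]
      rw [← mul_assoc, ← Real.rpow_add ht.1]
      congr 2
      ring
    have e2 : t ^ (a + 1) / (a + 1) = t ^ (2 * (a + 1)) * G t := by
      simp only [G]
      rw [← mul_div_assoc, ← Real.rpow_add ht.1]
      congr 2
      ring
    have hp := Real.rpow_pos_of_pos ht.1 (2 * (a + 1))
    rw [e1, e2, norm_mul, Real.norm_eq_abs, Real.norm_eq_abs, abs_of_pos hp, ← mul_add]
    exact mul_le_mul_of_nonneg_left h3 hp.le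
  refine squeeze_zero_norm' hbound ?_
  have h1 := (tendsto_rpow_nhdsGT_zero (p := 2 * (a + 1)) (by linarith)).mul_const (|g (ρ / 2)|)
  have h2 := (tendsto_rpow_nhdsGT_zero (p := a + 1) (by linarith)).div_const (a + 1)
  simpa using h1.add h2

/-- The Wronskian is constant, so its limit at 0 decides. The regular pair is of order (t^(a+1/2),
t^(a+3/2)), enough to beat the growth of v, while s u = o(√t). The factor s stays because the
boundary condition controls only s u. -/
theorem mul_wronskian_eq_zero (ha : -1 < a) (h : IsSingularTriple a s v u) {x : ℝ}
    (hx : x ∈ Ioo (0 : ℝ) 1) : s * (v x * regLeft a s x - u x * regRight a s x) = 0 := by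
  have hlim : Tendsto (fun t => s * (v t * regLeft a s t - u t * regRight a s t)) (𝓝[>] 0)
      (𝓝 0) := by
    have hc1 : Tendsto (fun t => s * (s / (2 * (a + 1)) * hypLim (a + 1) (-((s * t) ^ 2 / 4))))
        (𝓝[>] 0) (𝓝 (s * (s / (2 * (a + 1)) * hypLim (a + 1) (-((s * 0) ^ 2 / 4))))) :=
      (((continuous_hypLim_comp (by linarith) s).tendsto 0).const_mul _ |>.const_mul _).mono_left
        nhdsWithin_le_nhds
    have hc2 : Tendsto (fun t => hypLim a (-((s * t) ^ 2 / 4)))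
        (𝓝[>] 0) (𝓝 (hypLim a (-((s * 0) ^ 2 / 4)))) :=
      ((continuous_hypLim_comp ha s).tendsto 0).mono_left nhdsWithin_le_nhds
    have h1 := (h.tendsto_rpow_mul_right ha).mul hc1
    have h2 := (h.tendsto_left_zero.mul
      (tendsto_rpow_nhdsGT_zero (p := a + 1) (by linarith))).mul hc2
    have h3 := h1.sub h2
    simp only [zero_mul, sub_zero] at h3
    refine h3.congr' ?_
    filter_upwards [self_mem_nhdsWithin] with t ht
    have ht0 : 0 < t := ht
    have e : t ^ (a + 1) = Real.sqrt t * t ^ (a + 1 / 2) := by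
      rw [Real.sqrt_eq_rpow, ← Real.rpow_add ht0]
      congr 1
      ring
    have hs := (Real.sqrt_pos.2 ht0).ne'
    rw [e, regLeft, regRight]
    field_simp
  have hconst : Tendsto (fun t => s * (v t * regLeft a s t - u t * regRight a s t)) (𝓝[>] 0)
      (𝓝 (s * (v x * regLeft a s x - u x * regRight a s x))) := by
    refine tendsto_const_nhds.congr' ?_
    filter_upwards [Ioo_mem_nhdsGT (zero_lt_one' ℝ)] with t ht
    rw [h.besselSystem.wronskian_eq (besselSystem_reg ha s 1) hx ht]
  exact tendsto_nhds_unique hconst hlim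

/-- Otherwise the regular solution has no zero near 1, the ratio v / `regRight` is constant there,
and v(1) = 0 makes it zero. Then v, and with it s u, vanish near 1, and uniqueness gives v = 0
everywhere. -/
theorem hypLim_eq_zero (ha : -1 < a) (h : IsSingularTriple a s v u) :
    hypLim a (-(s ^ 2 / 4)) = 0 := by
  by_contra hne
  have hcont : Continuous fun x => hypLim a (-((s * x) ^ 2 / 4)) := continuous_hypLim_comp ha s
  have hne1 : (fun x => hypLim a (-((s * x) ^ 2 / 4))) 1 ≠ 0 := by simpa using hne
  have hev : ∀ᶠ x in 𝓝[<] (1 : ℝ), hypLim a (-((s * x) ^ 2 / 4)) ≠ 0 :=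
    (hcont.continuousAt.eventually_ne hne1).filter_mono nhdsWithin_le_nhds
  obtain ⟨p, hp1, hp⟩ := (mem_nhdsLT_iff_exists_Ioo_subset).1 hev
  set q := max p 0
  have hq1 : q < 1 := max_lt hp1 one_pos
  have hsub : Ioo q 1 ⊆ Ioo 0 1 := Ioo_subset_Ioo_left (le_max_right _ _)
  have hV : ∀ x ∈ Ioo q 1, regRight a s x ≠ 0 := fun x hx =>
    mul_ne_zero (Real.rpow_pos_of_pos (hsub hx).1 _).ne'
      (hp ⟨(le_max_left _ _).trans_lt hx.1, hx.2⟩)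
  have hder : ∀ x ∈ Ioo q 1, HasDerivAt (fun x => v x / regRight a s x) 0 x := fun x hx => by
    have := h.besselSystem.hasDerivAt_div (besselSystem_reg ha s 1) (hsub hx) (hV x hx)
    rwa [h.mul_wronskian_eq_zero ha (hsub hx), zero_div] at this
  have hVlim : Tendsto (regRight a s) (𝓝[<] 1) (𝓝 (hypLim a (-(s ^ 2 / 4)))) := by
    have h1 := (Real.continuousAt_rpow_const 1 (a + 1 / 2) (Or.inl one_ne_zero)).tendsto
    have h2 := h1.mul (hcont.tendsto 1)
    rw [Real.one_rpow, one_mul, mul_one] at h2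
    exact h2.mono_left nhdsWithin_le_nhds
  have hlim0 : Tendsto (fun x => v x / regRight a s x) (𝓝[<] 1) (𝓝 0) := by
    have := h.tendsto_right_one.div hVlim hne
    rwa [zero_div] at this
  have hv0 : ∀ x ∈ Ioo q 1, v x = 0 := fun x hx => by
    have hc : Tendsto (fun x => v x / regRight a s x) (𝓝[<] 1) (𝓝 (v x / regRight a s x)) := by
      refine tendsto_const_nhds.congr' ?_
      filter_upwards [Ioo_mem_nhdsLT hq1] with t ht
      exact eq_of_hasDerivAt_zero hder hx ht
    exact (div_eq_zero_iff.1 (tendsto_nhds_unique hc hlim0)).resolve_right (hV x hx)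
  obtain ⟨x₁, hx₁⟩ : (Ioo q 1).Nonempty := nonempty_Ioo.2 hq1
  have hsu : s * u x₁ = 0 := by
    have hd := h.besselSystem.right x₁ (hsub hx₁)
    have hd0 : HasDerivAt v 0 x₁ := (hasDerivAt_const x₁ (0 : ℝ)).congr_of_eventuallyEq (by
      filter_upwards [Ioo_mem_nhds hx₁.1 hx₁.2] with t ht
      exact hv0 t ht)
    have := hd.unique hd0
    rw [hv0 x₁ hx₁] at this
    linarith
  obtain ⟨x, hx, hvx⟩ := h.nontrivial
  refine hvx ?_
  by_cases hs : s = 0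
  -- For s = 0 the equations decouple and nothing is known of u; it is replaced by 0.
  · have hsys : BesselSystem (a + 1 / 2) 0 1 v 0 :=
      ⟨fun t ht => by simpa [hs] using h.besselSystem.right t ht,
        fun t _ => (hasDerivAt_const t (0 : ℝ)).congr_deriv (by simp)⟩
    exact (hsys.eq_zero (hsub hx₁) (hv0 x₁ hx₁) rfl hx).1
  · exact (h.besselSystem.eq_zero (hsub hx₁) (hv0 x₁ hx₁)
      ((mul_eq_zero.1 hsu).resolve_left hs) hx).1

end IsSingularTriple

/-- For p = a + 1/2, the exponent of `regRight`, the condition is exactly a > -1. -/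
theorem memLp_rpow_mul {p : ℝ} (hp : -1 < 2 * p) {f : ℝ → ℝ} (hf : Continuous f) :
    MemLp (fun x => x ^ p * f x) 2 (volume.restrict (Ioo 0 1)) := by
  have hmeas : AEStronglyMeasurable (fun x => x ^ p * f x) (volume.restrict (Ioo (0 : ℝ) 1)) :=
    ((measurable_id.pow_const p).mul hf.measurable).aestronglyMeasurable
  rw [memLp_two_iff_integrable_sq hmeas]
  have h1 : IntegrableOn (fun x : ℝ => x ^ (2 * p)) (Ioo 0 1) :=
    (intervalIntegral.integrableOn_Ioo_rpow_iff one_pos).2 hp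
  have h2 : IntegrableOn (fun x : ℝ => x ^ (2 * p) * f x ^ 2) (Ioo 0 1) :=
    h1.mul_continuousOn_of_subset (hf.pow 2).continuousOn measurableSet_Ioo
      (isCompact_Icc (a := (0 : ℝ)) (b := 1)) Ioo_subset_Icc_self
  refine h2.congr_fun (fun x hx => ?_) measurableSet_Ioo
  simp only [mul_pow]
  rw [← Real.rpow_natCast (x ^ p) 2, ← Real.rpow_mul hx.1.le]
  congr 2
  push_cast
  ring

/-- The regular solution meets the condition at 0 for every s, since s u(t)/√t is of order t^(a+1);
only the condition at 1 selects s. -/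
theorem isSingularTriple_reg (ha : -1 < a) {s : ℝ} (h0 : hypLim a (-(s ^ 2 / 4)) = 0) :
    IsSingularTriple a s (regRight a s) (regLeft a s) where
  differentiableOn_right x hx :=
    ((besselSystem_reg ha s 1).right x hx).differentiableAt.differentiableWithinAt
  differentiableOn_left x hx :=
    ((besselSystem_reg ha s 1).left x hx).differentiableAt.differentiableWithinAt
  memLp_right := memLp_rpow_mul (by linarith) (continuous_hypLim_comp ha s)
  memLp_left := memLp_rpow_mul (by linarith)
    ((continuous_hypLim_comp (by linarith) s).const_mul _)
  boundary := by
    constructor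
    · have h1 := (Real.continuousAt_rpow_const 1 (-(1 / 4)) (Or.inl one_ne_zero)).tendsto
      have h2 : ContinuousAt (fun x => regRight a s (Real.sqrt x)) 1 := by
        refine ContinuousAt.comp (g := regRight a s) ?_ Real.continuous_sqrt.continuousAt
        rw [Real.sqrt_one]
        exact ((besselSystem_reg ha s 2).right 1 ⟨by norm_num, by norm_num⟩).continuousAt
      have h3 := h1.mul h2.tendsto
      rw [Real.sqrt_one, regRight, Real.one_rpow, mul_one, h0, mul_zero, mul_zero] at h3
      exact h3.mono_left nhdsWithin_le_nhds
    · have hs : Tendsto Real.sqrt (𝓝[>] 0) (𝓝[>] 0) := by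
        refine tendsto_nhdsWithin_iff.2 ⟨?_, ?_⟩
        · have := Real.continuous_sqrt.tendsto 0
          rw [Real.sqrt_zero] at this
          exact this.mono_left nhdsWithin_le_nhds
        · filter_upwards [self_mem_nhdsWithin] with t ht
          exact Real.sqrt_pos.2 ht
      have hc1 : Tendsto (fun t => s * (s / (2 * (a + 1)) * hypLim (a + 1) (-((s * t) ^ 2 / 4))))
          (𝓝[>] 0) (𝓝 (s * (s / (2 * (a + 1)) * hypLim (a + 1) (-((s * 0) ^ 2 / 4))))) :=
        (((continuous_hypLim_comp (by linarith) s).tendsto 0).const_mul _ |>.const_mul _).mono_left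
          nhdsWithin_le_nhds
      have h2 := ((tendsto_rpow_nhdsGT_zero (p := a + 1) (by linarith)).mul hc1).comp hs
      rw [zero_mul] at h2
      refine h2.congr' ?_
      filter_upwards [Ioo_mem_nhdsGT (zero_lt_one' ℝ)] with x hx
      set t := Real.sqrt x
      have ht0 : 0 < t := Real.sqrt_pos.2 hx.1
      have hxt : x = t ^ 2 := (Real.sq_sqrt hx.1.le).symm
      have hd := (besselSystem_reg ha s (t + 1)).right t ⟨ht0, by linarith⟩
      have hst := (Real.sqrt_pos.2 ht0).ne'
      rw [hxt, besselOp_fromLiouville a ht0 hd.differentiableAt, besselLiouville, hd.deriv]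
      have e : t ^ (a + 3 / 2) = Real.sqrt t * t ^ (a + 1) := by
        rw [Real.sqrt_eq_rpow, ← Real.rpow_add ht0]
        congr 1
        ring
      simp only [Function.comp, regLeft, e]
      field_simp
      simp [t]
      ring_nf
  nontrivial := by
    have hev : ∀ᶠ t in 𝓝 (0 : ℝ), hypLim a (-((s * t) ^ 2 / 4)) ≠ 0 :=
      (continuous_hypLim_comp ha s).continuousAt.eventually_ne (by simp [hypLim_zero])
    obtain ⟨x, hx, hxI⟩ := ((hev.filter_mono nhdsWithin_le_nhds).and
      (Ioo_mem_nhdsGT (zero_lt_one' ℝ))).exists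
    exact ⟨x, hxI, mul_ne_zero (Real.rpow_pos_of_pos hxI.1 _).ne' hx⟩
  apply_right x hx := by
    rw [besselLiouville, ((besselSystem_reg ha s 1).right x hx).deriv]
    ring
  apply_left x hx := by
    rw [besselLiouvilleAdj, ((besselSystem_reg ha s 1).left x hx).deriv]
    ring

theorem besselZeros_eq (ha : -1 < a) :
    besselZeros a = {x | 0 < x ∧ hypLim a (-(x ^ 2 / 4)) = 0} := by
  ext x
  exact and_congr_right fun hx => besselJ_eq_zero_iff ha hx

theorem besselSingularValues_eq (ha : -1 < a) : besselSingularValues a = besselZeros a := by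
  rw [besselZeros_eq ha]
  ext s
  constructor
  · rintro ⟨hs, v, u, h⟩
    have h0 := h.hypLim_eq_zero ha
    refine ⟨lt_of_le_of_ne hs fun e => ?_, h0⟩
    rw [← e] at h0
    simp [hypLim_zero] at h0
  · rintro ⟨hs, h0⟩
    exact ⟨hs.le, _, _, isSingularTriple_reg ha h0⟩

end JacobiBessel

/-! ### Stability of simple real zeros under C¹ convergence. -/

namespace JacobiBessel

/-! ### Enumeration of zeros and convergence of the `k`-th zero -/

/-- A locally finite linear order with a least and no greatest element is isomorphic to ℕ. -/
theorem exists_strictMono_range_eq {S : Set ℝ} (hfin : ∀ R, (S ∩ Iic R).Finite)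
    (hunb : ∀ R, ∃ x ∈ S, R < x) : ∃ ζ : ℕ → ℝ, StrictMono ζ ∧ range ζ = S := by
  classical
  have hIcc : ∀ x y : S, (Icc x y).Finite := fun x y => by
    refine Set.Finite.of_finite_image (f := Subtype.val) ((hfin y).subset ?_)
      Subtype.val_injective.injOn
    rintro _ ⟨z, hz, rfl⟩
    exact ⟨z.2, hz.2⟩
  let : LocallyFiniteOrder S := LocallyFiniteOrder.ofFiniteIcc hIcc
  let : SuccOrder S := LinearLocallyFiniteOrder.succOrder S
  let : PredOrder S := LinearLocallyFiniteOrder.predOrder S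
  have : NoMaxOrder S := ⟨fun x => by
    obtain ⟨y, hy, hxy⟩ := hunb x
    exact ⟨⟨y, hy⟩, hxy⟩⟩
  obtain ⟨x₀, hx₀, -⟩ := hunb 0
  obtain ⟨m, hm, hmin⟩ := (hfin x₀).exists_minimal ⟨x₀, hx₀, le_refl x₀⟩
  let : OrderBot S :=
    { bot := ⟨m, hm.1⟩
      bot_le := fun y => by
        show m ≤ y
        rcases le_total (y : ℝ) x₀ with h | h
        · rcases le_total m y with h' | h'
          · exact h'
          · exact hmin ⟨y.2, h⟩ h'
        · exact le_trans hm.2 h }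
  let e : S ≃o ℕ := orderIsoNatOfLinearSuccPredArch
  refine ⟨fun k => e.symm k, fun i j hij => e.symm.strictMono hij, ?_⟩
  ext x
  constructor
  · rintro ⟨k, rfl⟩
    exact (e.symm k).2
  · intro hx
    exact ⟨e ⟨x, hx⟩, by simp⟩

/-- Infinitely many zeros would accumulate in the compact interval at a zero, but a zero with
nonzero derivative is isolated. -/
theorem finite_zeros_Icc {f f' : ℝ → ℝ} (hf : ∀ x, HasDerivAt f (f' x) x) {p q : ℝ}
    (hsimple : ∀ x ∈ Icc p q, f x = 0 → f' x ≠ 0) : {x ∈ Icc p q | f x = 0}.Finite := by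
  by_contra hinf
  obtain ⟨x, hx, hacc⟩ := Set.Infinite.exists_accPt_of_subset_isCompact hinf
    (isCompact_Icc (a := p) (b := q)) fun x hx => hx.1
  have hfreq : ∃ᶠ y in 𝓝[≠] x, f y = 0 :=
    (accPt_iff_frequently_nhdsNE.1 hacc).mono fun y hy => hy.2
  have hfx : f x = 0 := by
    have hc : Tendsto f (𝓝[≠] x) (𝓝 (f x)) := (hf x).continuousAt.mono_left nhdsWithin_le_nhds
    by_contra hne
    exact hfreq (hc.eventually_ne hne)
  exact hfreq ((hf x).eventually_ne (hsimple x hx hfx))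

theorem eventually_forall_ne_zero {f : ℝ → ℝ} {g : ℕ → ℝ → ℝ} {p q : ℝ} (hp : 0 ≤ p)
    (hg : ∀ R : ℝ, 0 ≤ R → TendstoUniformlyOn g f atTop (Icc 0 R)) (hf : Continuous f)
    (hne : ∀ x ∈ Icc p q, f x ≠ 0) : ∀ᶠ n in atTop, ∀ x ∈ Icc p q, g n x ≠ 0 := by
  rcases lt_or_ge q p with hpq | hpq
  · simp [Icc_eq_empty_of_lt hpq]
  obtain ⟨x₀, hx₀, hmin⟩ := (isCompact_Icc (a := p) (b := q)).exists_isMinOn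
    (nonempty_Icc.2 hpq) hf.abs.continuousOn
  filter_upwards [Metric.tendstoUniformlyOn_iff.1 (hg q (hp.trans hpq)) |f x₀|
    (abs_pos.2 (hne x₀ hx₀))] with n hn x hx h0
  have h1 := hn x ⟨hp.trans hx.1, hx.2⟩
  have h2 : |f x₀| ≤ |f x| := hmin hx
  rw [h0, Real.dist_eq, sub_zero] at h1
  linarith

/-- Near a simple zero of the limit, the approximants eventually have exactly one zero. -/
theorem exists_isolating {f f' : ℝ → ℝ} {g g' : ℕ → ℝ → ℝ} (hf : ∀ x, HasDerivAt f (f' x) x)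
    (hf' : Continuous f') (hg : ∀ᶠ n in atTop, ∀ x, HasDerivAt (g n) (g' n x) x)
    (h0 : ∀ R : ℝ, 0 ≤ R → TendstoUniformlyOn g f atTop (Icc 0 R))
    (h1 : ∀ R : ℝ, 0 ≤ R → TendstoUniformlyOn g' f' atTop (Icc 0 R))
    {c ε : ℝ} (hc : 0 < c) (hε : 0 < ε) (hfc : f c = 0) (hf'c : f' c ≠ 0) :
    ∃ δ, 0 < δ ∧ δ < ε ∧ ∀ᶠ n in atTop, (∃ x ∈ Ioo (c - δ) (c + δ), g n x = 0) ∧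
      ∀ x ∈ Icc (c - δ) (c + δ), ∀ y ∈ Icc (c - δ) (c + δ), g n x = 0 → g n y = 0 → x = y := by
  wlog hpos : 0 < f' c generalizing f f' g g' with H
  · have hneg : ∀ {u : ℕ → ℝ → ℝ} {w : ℝ → ℝ}, (∀ R : ℝ, 0 ≤ R →
        TendstoUniformlyOn u w atTop (Icc 0 R)) → ∀ R : ℝ, 0 ≤ R →
        TendstoUniformlyOn (fun n x => -u n x) (fun x => -w x) atTop (Icc 0 R) := by
      intro u w hu R hR
      rw [Metric.tendstoUniformlyOn_iff]
      intro e he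
      filter_upwards [Metric.tendstoUniformlyOn_iff.1 (hu R hR) e he] with n hn x hx
      rw [dist_neg_neg]
      exact hn x hx
    have := H (f := fun x => -f x) (f' := fun x => -f' x) (g := fun n x => -g n x)
      (g' := fun n x => -g' n x) (fun x => (hf x).neg) hf'.neg
      (hg.mono fun n hn x => (hn x).neg) (hneg h0) (hneg h1) (by simpa using hfc)
      (by simpa using hf'c) (by
        have := lt_of_le_of_ne (not_lt.1 hpos) hf'c
        linarith)
    simpa only [neg_eq_zero] using this
  have hcf : Continuous f := continuous_iff_continuousAt.2 fun x => (hf x).continuousAt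
  obtain ⟨r, hr, hball⟩ := Metric.eventually_nhds_iff.1 (hf'.continuousAt.eventually_const_lt hpos)
  -- The bound r/2 keeps f' positive on the interval; c/2 keeps the interval inside x ≥ 0, where
  -- convergence is known.
  set δ := min (min (r / 2) (ε / 2)) (c / 2)
  have hδ0 : 0 < δ := by simp only [δ, lt_min_iff]; refine ⟨⟨?_, ?_⟩, ?_⟩ <;> linarith
  have hδr : δ ≤ r / 2 := (min_le_left _ _).trans (min_le_left _ _)
  have hδε : δ ≤ ε / 2 := (min_le_left _ _).trans (min_le_right _ _)
  have hδc : δ ≤ c / 2 := min_le_right _ _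
  have hder : ∀ x ∈ Icc (c - δ) (c + δ), 0 < f' x := fun x hx => by
    refine hball ?_
    rw [Real.dist_eq, abs_lt]
    constructor <;> linarith [hx.1, hx.2]
  have hmono : StrictMonoOn f (Icc (c - δ) (c + δ)) :=
    strictMonoOn_of_deriv_pos (convex_Icc _ _) hcf.continuousOn fun x hx => by
      rw [(hf x).deriv]
      exact hder x (interior_subset hx)
  have hmem : ∀ t ∈ Icc (-δ) δ, c + t ∈ Icc (c - δ) (c + δ) := fun t ht =>
    ⟨by linarith [ht.1], by linarith [ht.2]⟩
  have hlo : f (c - δ) < 0 := hfc ▸ hmono (by constructor <;> linarith)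
    (by constructor <;> linarith) (by linarith)
  have hhi : 0 < f (c + δ) := hfc ▸ hmono (by constructor <;> linarith)
    (by constructor <;> linarith) (by linarith)
  have hpt : ∀ x, 0 ≤ x → Tendsto (fun n => g n x) atTop (𝓝 (f x)) := fun x hx =>
    (h0 x hx).tendsto_at ⟨hx, le_rfl⟩
  refine ⟨δ, hδ0, by linarith, ?_⟩
  filter_upwards [hg, (hpt (c - δ) (by linarith)).eventually_lt_const hlo,
    (hpt (c + δ) (by linarith)).eventually_const_lt hhi,
    eventually_forall_ne_zero (p := c - δ) (q := c + δ) (by linarith) h1 hf'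
      fun x hx => (hder x hx).ne'] with n hgn hn1 hn2 hn3
  have hgc : Continuous (g n) := continuous_iff_continuousAt.2 fun x => (hgn x).continuousAt
  constructor
  · exact intermediate_value_Ioo (by linarith) hgc.continuousOn ⟨hn1, hn2⟩
  -- Rolle: two zeros of g n would enclose a zero of its derivative, excluded on this interval for
  -- large n.
  · have key : ∀ x ∈ Icc (c - δ) (c + δ), ∀ y ∈ Icc (c - δ) (c + δ), g n x = 0 → g n y = 0 →
        ¬ x < y := by
      intro x hx y hy hx0 hy0 hxy
      obtain ⟨z, hz, hz0⟩ := exists_hasDerivAt_eq_zero hxy hgc.continuousOn (hx0.trans hy0.symm)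
        fun z _ => hgn z
      exact hn3 z ⟨hx.1.trans hz.1.le, hz.2.le.trans hy.2⟩ hz0
    intro x hx y hy hx0 hy0
    exact le_antisymm (not_lt.1 (key y hy x hx hy0 hx0)) (not_lt.1 (key x hx y hy hx0 hy0))

/-- If `g n` converges to `f` together with the derivatives, then the `k`-th positive zero of `g n`
converges to the `k`-th positive zero of `f`, provided that the latter are simple. -/
theorem tendsto_kth_zero {f f' : ℝ → ℝ} {g g' : ℕ → ℝ → ℝ} (hf : ∀ x, HasDerivAt f (f' x) x)
    (hf' : Continuous f') (hg : ∀ᶠ n in atTop, ∀ x, HasDerivAt (g n) (g' n x) x)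
    (h0 : ∀ R : ℝ, 0 ≤ R → TendstoUniformlyOn g f atTop (Icc 0 R))
    (h1 : ∀ R : ℝ, 0 ≤ R → TendstoUniformlyOn g' f' atTop (Icc 0 R))
    (hf0 : f 0 ≠ 0) {ζ : ℕ → ℝ} (hζ : StrictMono ζ) (hζr : range ζ = {x | 0 < x ∧ f x = 0})
    (hsimple : ∀ x, 0 < x → f x = 0 → f' x ≠ 0) {μ : ℕ → ℕ → ℝ}
    (hμ : ∀ᶠ n in atTop, StrictMonoOn (μ n) (Iio n) ∧ ∀ x, 0 < x →
      (g n x = 0 ↔ ∃ k < n, μ n k = x))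
    (hμ0 : ∀ᶠ n in atTop, ∀ k < n, 0 < μ n k) (k : ℕ) :
    Tendsto (fun n => μ n k) atTop (𝓝 (ζ k)) := by
  have hcf : Continuous f := continuous_iff_continuousAt.2 fun x => (hf x).continuousAt
  have hζz : ∀ k, 0 < ζ k ∧ f (ζ k) = 0 := fun k => by
    have : ζ k ∈ range ζ := mem_range_self k
    rwa [hζr] at this
  have hζe : ∀ x, 0 < x → f x = 0 → ∃ k, ζ k = x := fun x hx hx0 => by
    have : x ∈ range ζ := by rw [hζr]; exact ⟨hx, hx0⟩
    exact this
  have hiso := fun k ε (hε : 0 < ε) => exists_isolating hf hf' hg h0 h1 (hζz k).1 hε (hζz k).2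
    (hsimple _ (hζz k).1 (hζz k).2)
  -- The threshold p separates the k smallest zeros from the next one, both for f and, eventually,
  -- for g n. The induction moves it just past ζ k.
  have hsep : ∀ k, ∃ p, 0 ≤ p ∧ p < ζ k ∧ (∀ x ∈ Ico p (ζ k), f x ≠ 0) ∧
      ∀ᶠ n in atTop, (∀ j < k, μ n j < p) ∧ p < μ n k := by
    intro k
    induction k with
    | zero =>
      refine ⟨0, le_rfl, (hζz 0).1, fun x hx hx0 => ?_, ?_⟩
      · rcases hx.1.eq_or_lt with h | h
        · exact hf0 (h ▸ hx0)
        · obtain ⟨j, rfl⟩ := hζe x h hx0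
          exact absurd (hζ.lt_iff_lt.1 hx.2) (Nat.not_lt_zero j)
      · filter_upwards [hμ0, eventually_gt_atTop 0] with n hn hn0
        exact ⟨fun j hj => absurd hj (Nat.not_lt_zero j), hn 0 hn0⟩
    | succ k ih =>
      obtain ⟨p, hp0, hpζ, hpne, hpμ⟩ := ih
      obtain ⟨δ, hδ0, hδ, hev⟩ := hiso k (min (ζ k - p) (ζ (k + 1) - ζ k))
        (lt_min (by linarith) (by linarith [hζ (Nat.lt_succ_self k)]))
      have hδ1 := hδ.trans_le (min_le_left _ _)
      have hδ2 := hδ.trans_le (min_le_right _ _)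
      refine ⟨ζ k + δ, by linarith [(hζz k).1], by linarith, fun x hx hx0 => ?_, ?_⟩
      · obtain ⟨j, rfl⟩ := hζe x (by linarith [(hζz k).1, hx.1]) hx0
        have hj1 := hζ.lt_iff_lt.1 hx.2
        have hj2 : k < j := hζ.lt_iff_lt.1 (by linarith [hx.1])
        omega
      · filter_upwards [hpμ, hev, hμ, hμ0, eventually_gt_atTop (k + 1),
          eventually_forall_ne_zero (p := p) (q := ζ k - δ) hp0 h0 hcf
            fun x hx => hpne x ⟨hx.1, by linarith [hx.2]⟩] with n hn1 hn2 hn3 hn4 hn5 hn6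
        obtain ⟨⟨x, hx, hx0⟩, huniq⟩ := hn2
        have hkz : ∀ j < n, g n (μ n j) = 0 := fun j hj =>
          (hn3.2 _ (hn4 j hj)).2 ⟨j, hj, rfl⟩
        obtain ⟨j, hj, rfl⟩ := (hn3.2 x (by linarith [hx.1])).1 hx0
        have hkj : k ≤ j := not_lt.1 fun h => by linarith [hn1.1 j h, hx.1]
        have hkn : k < n := by omega
        have hle : μ n k ≤ μ n j := hn3.1.monotoneOn hkn hj hkj
        have hlow : ζ k - δ < μ n k := not_le.1 fun h =>
          hn6 (μ n k) ⟨hn1.2.le, h⟩ (hkz k hkn)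
        have hlt : μ n k < μ n (k + 1) := hn3.1 hkn hn5 (Nat.lt_succ_self k)
        refine ⟨fun i hi => ?_, not_le.1 fun h => ?_⟩
        · have : μ n i ≤ μ n k := hn3.1.monotoneOn (mem_Iio.2 (by omega)) hkn (by omega)
          linarith [hx.2]
        -- Both zeros would lie in the isolating interval of ζ k, which holds only one.
        · exact hlt.ne (huniq _ ⟨hlow.le, by linarith⟩ _ ⟨by linarith, h⟩ (hkz k hkn)
            (hkz _ hn5))
  obtain ⟨p, hp0, hpζ, hpne, hpμ⟩ := hsep k
  rw [Metric.tendsto_nhds]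
  intro ε hε
  obtain ⟨δ, hδ0, hδ, hev⟩ := hiso k (min (ζ k - p) ε) (lt_min (by linarith) hε)
  have hδ1 := hδ.trans_le (min_le_left _ _)
  have hδ2 := hδ.trans_le (min_le_right _ _)
  filter_upwards [hpμ, hev, hμ, hμ0, eventually_gt_atTop k,
    eventually_forall_ne_zero (p := p) (q := ζ k - δ) hp0 h0 hcf
      fun x hx => hpne x ⟨hx.1, by linarith [hx.2]⟩] with n hn1 hn2 hn3 hn4 hkn hn6
  obtain ⟨⟨x, hx, hx0⟩, -⟩ := hn2
  obtain ⟨j, hj, rfl⟩ := (hn3.2 x (by linarith [hx.1])).1 hx0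
  have hkj : k ≤ j := not_lt.1 fun h => by linarith [hn1.1 j h, hx.1]
  have hle : μ n k ≤ μ n j := hn3.1.monotoneOn hkn hj hkj
  have hlow : ζ k - δ < μ n k := not_le.1 fun h =>
    hn6 (μ n k) ⟨hn1.2.le, h⟩ ((hn3.2 _ (hn4 k hkn)).2 ⟨k, hkn, rfl⟩)
  rw [Real.dist_eq, abs_lt]
  constructor <;> linarith [hx.2]

end JacobiBessel

/-! ### The discrete side: Jacobi polynomials and spectra of bidiagonal matrices. -/

namespace JacobiBessel

/-! ### Gauss hypergeometric coefficients and Jacobi polynomials -/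

/-- The coefficients `(A)ₖ (B)ₖ / ((C)ₖ k!)` of `₂F₁(A, B; C; x)`. -/
noncomputable def hypCoeff (A B C : ℝ) (k : ℕ) : ℝ :=
  ∏ j ∈ Finset.range k, ((A + j) * (B + j) / ((C + j) * (1 + j)))

variable {a b : ℝ}

theorem hypCoeff_succ (A B C : ℝ) (k : ℕ) :
    hypCoeff A B C (k + 1) = hypCoeff A B C k * ((A + k) * (B + k) / ((C + k) * (1 + k))) :=
  Finset.prod_range_succ _ _

theorem hypCoeff_shift_left (A B C : ℝ) (k : ℕ) :
    A * hypCoeff (A + 1) B C k = (A + k) * hypCoeff A B C k := by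
  induction k with
  | zero => simp [hypCoeff]
  | succ k ih =>
    rw [hypCoeff_succ, ← mul_assoc, ih, hypCoeff_succ]
    push_cast
    ring

theorem hypCoeff_comm (A B C : ℝ) (k : ℕ) : hypCoeff A B C k = hypCoeff B A C k :=
  Finset.prod_congr rfl fun j _ => by ring

theorem hypCoeff_shift_right (A B C : ℝ) (k : ℕ) :
    B * hypCoeff A (B + 1) C k = (B + k) * hypCoeff A B C k := by
  rw [hypCoeff_comm, hypCoeff_shift_left, hypCoeff_comm]

theorem hypCoeff_shift_denom (A B : ℝ) {C : ℝ} (hC : 0 < C) (k : ℕ) :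
    (C + k) * hypCoeff A B (C + 1) k = C * hypCoeff A B C k := by
  induction k with
  | zero => simp [hypCoeff]
  | succ k ih =>
    have h1 : C + (k : ℝ) ≠ 0 := by positivity
    have h2 : C + 1 + (k : ℝ) ≠ 0 := by positivity
    have h3 : 1 + (k : ℝ) ≠ 0 := by positivity
    rw [hypCoeff_succ A B C, ← mul_assoc, ← ih, hypCoeff_succ]
    push_cast
    field_simp
    ring

/-- Coefficient form of the derivative formula of ₂F₁. -/
theorem hypCoeff_succ_eq (A B : ℝ) {C : ℝ} (hC : 0 < C) (k : ℕ) :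
    C * (k + 1) * hypCoeff A B C (k + 1) = A * B * hypCoeff (A + 1) (B + 1) (C + 1) k := by
  have h1 : C + (k : ℝ) ≠ 0 := by positivity
  have h3 : 1 + (k : ℝ) ≠ 0 := by positivity
  have e1 := hypCoeff_shift_left A (B + 1) (C + 1) k
  have e2 := hypCoeff_shift_right A B (C + 1) k
  have e3 := hypCoeff_shift_denom A B hC k
  have e4 : A * B * hypCoeff (A + 1) (B + 1) (C + 1) k =
      (A + k) * (B + k) * hypCoeff A B (C + 1) k := by linear_combination B * e1 + (A + k) * e2
  rw [e4, hypCoeff_succ]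
  field_simp
  linear_combination -(A + k) * (B + k) * (1 + (k : ℝ)) * e3

theorem hypCoeff_neg_eq_zero (n : ℕ) (B C : ℝ) {k : ℕ} (hk : n < k) :
    hypCoeff (-n) B C k = 0 :=
  Finset.prod_eq_zero (Finset.mem_range.2 hk) (by simp)

/-- The polynomial `₂F₁(-n, B; C; x)`. -/
noncomputable def hypPoly (n : ℕ) (B C x : ℝ) : ℝ := ∑' k, hypCoeff (-n) B C k * x ^ k

theorem summable_hypCoeff_neg (n : ℕ) (B C x : ℝ) :
    Summable fun k => hypCoeff (-n) B C k * x ^ k :=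
  summable_of_ne_finset_zero (s := Finset.range (n + 1)) fun k hk => by
    rw [hypCoeff_neg_eq_zero n B C (by simpa using hk), zero_mul]

theorem hypPoly_zero_right (n : ℕ) (B C : ℝ) : hypPoly n B C 0 = 1 := by
  rw [hypPoly, tsum_eq_single 0 fun k hk => by simp [hk]]
  simp [hypCoeff]

theorem hypPoly_zero_left (B C x : ℝ) : hypPoly 0 B C x = 1 := by
  rw [hypPoly, tsum_eq_single 0 fun k hk => by
    rw [hypCoeff_neg_eq_zero 0 B C (Nat.pos_of_ne_zero hk), zero_mul]]
  simp [hypCoeff]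

/-- The Jacobi polynomial of degree `n` for the weight `xᵃ (1 - x)ᵇ` on `(0, 1)`, with value `1` at
`0`. -/
noncomputable def jacobiPoly (a b : ℝ) (n : ℕ) (x : ℝ) : ℝ :=
  hypPoly n (n + (a + b + 1)) (a + 1) x

/-- Consecutive polynomials agree at 0, so x divides their difference; the quotient is a multiple of
the Jacobi polynomial with a raised to a + 1. This describes the intermediate vector A q. -/
theorem jacobiPoly_sub_succ (ha : -1 < a) (n : ℕ) (x : ℝ) :
    (a + 1) * (jacobiPoly a b n x - jacobiPoly a b (n + 1) x) =
      x * ((2 * n + a + b + 2) * hypPoly n (n + (a + b + 2)) (a + 2) x) := by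
  have hC : 0 < a + 1 := by linarith
  have hs0 := summable_hypCoeff_neg n (n + (a + b + 1)) (a + 1) x
  have hs1 := summable_hypCoeff_neg (n + 1) ((n + 1 : ℕ) + (a + b + 1)) (a + 1) x
  rw [jacobiPoly, jacobiPoly, hypPoly, hypPoly, hypPoly, ← hs0.tsum_sub hs1,
    (hs0.sub hs1).tsum_eq_zero_add, ← tsum_mul_left, ← tsum_mul_left]
  have hz : ∀ A B C : ℝ, hypCoeff A B C 0 = 1 := fun A B C => by simp [hypCoeff]
  rw [hz, hz, sub_self, zero_add, ← tsum_mul_left]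
  refine tsum_congr fun k => ?_
  have hk : ((k : ℝ) + 1) ≠ 0 := by positivity
  have e1 := hypCoeff_succ_eq (-(n : ℝ)) (n + (a + b + 1)) hC k
  have e2 := hypCoeff_succ_eq (-((n + 1 : ℕ) : ℝ)) ((n + 1 : ℕ) + (a + b + 1)) hC k
  have e3 := hypCoeff_shift_left (-(n : ℝ)) (n + (a + b + 2)) (a + 2) k
  have e4 := hypCoeff_shift_right (-(n : ℝ)) (n + (a + b + 2)) (a + 2) k
  rw [show (n : ℝ) + (a + b + 1) + 1 = n + (a + b + 2) by ring,
    show a + 1 + 1 = a + 2 by ring] at e1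
  push_cast at e2 ⊢
  rw [show -((n : ℝ) + 1) + 1 = -n by ring,
    show (n : ℝ) + 1 + (a + b + 1) + 1 = n + (a + b + 2) + 1 by ring,
    show a + 1 + 1 = a + 2 by ring] at e2
  have key : (a + 1) * (hypCoeff (-(n : ℝ)) (n + (a + b + 1)) (a + 1) (k + 1) -
      hypCoeff (-((n : ℝ) + 1)) (n + 1 + (a + b + 1)) (a + 1) (k + 1)) =
      (2 * n + a + b + 2) * hypCoeff (-(n : ℝ)) (n + (a + b + 2)) (a + 2) k := by
    refine mul_left_cancel₀ hk ?_
    linear_combination e1 - e2 + (n + (a + b + 1)) * e3 + (n + 1) * e4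
  linear_combination x * x ^ k * key

/-- The way back from parameter a + 1 to a, which is the action of Aᵀ. -/
theorem jacobiPoly_succ_eq (ha : -1 < a) (n : ℕ) (x : ℝ) :
    (a + (n + 1) + 1) * (a + b + (n + 1) + 1) *
        hypPoly (n + 1) ((n + 1 : ℕ) + (a + b + 2)) (a + 2) x -
      (b + (n + 1)) * (n + 1) * hypPoly n (n + (a + b + 2)) (a + 2) x =
      (a + 1) * (a + b + 2 * (n + 1) + 1) * jacobiPoly a b (n + 1) x := by
  have hC : 0 < a + 1 := by linarith
  have hs0 := summable_hypCoeff_neg n (n + (a + b + 2)) (a + 2) x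
  have hs1 := summable_hypCoeff_neg (n + 1) ((n + 1 : ℕ) + (a + b + 2)) (a + 2) x
  rw [jacobiPoly, hypPoly, hypPoly, hypPoly, ← tsum_mul_left, ← tsum_mul_left, ← tsum_mul_left,
    ← (hs1.mul_left _).tsum_sub (hs0.mul_left _)]
  refine tsum_congr fun k => ?_
  set N : ℝ := ((n + 1 : ℕ) : ℝ)
  have hN : (n : ℝ) = N - 1 := by simp [N]
  have hN0 : N ≠ 0 := by simp only [N]; positivity
  rw [hN]
  have hk : a + 1 + (k : ℝ) ≠ 0 := by positivity
  have e1 := hypCoeff_shift_denom (-N) (N + (a + b + 1)) hC k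
  have e2 := hypCoeff_shift_right (-N) (N + (a + b + 1)) (a + 2) k
  have e3 := hypCoeff_shift_left (-N) (N + (a + b + 1)) (a + 2) k
  rw [show a + 1 + 1 = a + 2 by ring] at e1
  rw [show N + (a + b + 1) + 1 = N + (a + b + 2) by ring] at e2
  rw [show -N + 1 = -(N - 1) by ring] at e3
  rw [show N - 1 + (a + b + 2) = N + (a + b + 1) by ring]
  set c := hypCoeff (-N) (N + (a + b + 1)) (a + 1) k
  set r := hypCoeff (-N) (N + (a + b + 2)) (a + 2) k
  set r' := hypCoeff (-(N - 1)) (N + (a + b + 1)) (a + 2) k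
  set m := hypCoeff (-N) (N + (a + b + 1)) (a + 2) k
  have key : (a + (N - 1 + 1) + 1) * (a + b + (N - 1 + 1) + 1) * r -
      (b + (N - 1 + 1)) * (N - 1 + 1) * r' = (a + 1) * (a + b + 2 * (N - 1 + 1) + 1) * c := by
    linear_combination (a + N + 1) * e2 + (b + N) * e3 + (a + b + 2 * N + 1) * e1
  linear_combination x ^ k * key

/-! ### Singular values of upper bidiagonal matrices -/

/-- The upper bidiagonal matrix with diagonal `d` and superdiagonal `e`. -/
def bidiag (n : ℕ) (d e : ℕ → ℝ) : Matrix (Fin n) (Fin n) ℝ :=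
  Matrix.of fun i j => if j.val = i.val then d i else if j.val = i.val + 1 then e i else 0

/-- Extension of a vector by zero. -/
def extendZero {n : ℕ} (w : Fin n → ℝ) (k : ℕ) : ℝ := if h : k < n then w ⟨k, h⟩ else 0

theorem extendZero_val {n : ℕ} (w : Fin n → ℝ) (i : Fin n) : extendZero w i = w i := by
  simp [extendZero]

theorem extendZero_of_le {n : ℕ} (w : Fin n → ℝ) {k : ℕ} (hk : n ≤ k) : extendZero w k = 0 := by
  simp [extendZero, hk]

theorem bidiag_mulVec {n : ℕ} (d e : ℕ → ℝ) (w : Fin n → ℝ) (i : Fin n) :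
    (bidiag n d e).mulVec w i = d i * extendZero w i + e i * extendZero w (i + 1) := by
  have h : (bidiag n d e).mulVec w i = ∑ j : Fin n,
      ((if j.val = i.val then d i * extendZero w i else 0) +
        (if j.val = i.val + 1 then e i * extendZero w (i + 1) else 0)) := by
    rw [Matrix.mulVec, dotProduct]
    refine Finset.sum_congr rfl fun j _ => ?_
    simp only [bidiag, Matrix.of_apply]
    rw [← extendZero_val w j]
    split_ifs with h1 h2 h2
    · omega
    · rw [h1, add_zero]
    · rw [h2, zero_add]
    · simp
  rw [h, Fin.sum_univ_eq_sum_range (fun j => (if j = i.val then d i * extendZero w i else 0) +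
        (if j = i.val + 1 then e i * extendZero w (i + 1) else 0)) n, Finset.sum_add_distrib,
    Finset.sum_ite_eq', Finset.sum_ite_eq', if_pos (Finset.mem_range.2 i.2)]
  congr 1
  split_ifs with h1
  · rfl
  · rw [extendZero_of_le w (by simpa using h1), mul_zero]

theorem bidiag_transpose_mulVec {n : ℕ} (d e : ℕ → ℝ) (y : Fin n → ℝ) (i : Fin n) :
    (bidiag n d e).transpose.mulVec y i =
      d i * extendZero y i + (if i.val = 0 then 0 else e (i - 1) * extendZero y (i - 1)) := by
  have h : (bidiag n d e).transpose.mulVec y i = ∑ j : Fin n,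
      ((if j.val = i.val then d i * extendZero y i else 0) + (if j.val = i.val - 1 then
        (if i.val = 0 then 0 else e (i - 1) * extendZero y (i - 1)) else 0)) := by
    rw [Matrix.mulVec, dotProduct]
    refine Finset.sum_congr rfl fun j _ => ?_
    simp only [bidiag, Matrix.of_apply, Matrix.transpose_apply]
    rw [← extendZero_val y j]
    by_cases h1 : i.val = j.val
    · by_cases h2 : i.val = 0
      · simp [← h1, h2]
      · have h3 : j.val ≠ i.val - 1 := by omega
        rw [if_pos h1, if_pos h1.symm, if_neg h3, h1, add_zero]
    · by_cases h2 : i.val = j.val + 1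
      · have h3 : j.val = i.val - 1 := by omega
        have h4 : i.val ≠ 0 := by omega
        rw [if_neg h1, if_pos h2, if_neg (Ne.symm h1), if_pos h3, if_neg h4, h3, zero_add]
      · by_cases h4 : i.val = 0
        · have h5 : j.val ≠ 0 := by omega
          simp [h4, h5, Ne.symm h5]
        · have h3 : j.val ≠ i.val - 1 := by omega
          rw [if_neg h1, if_neg h2, if_neg (Ne.symm h1), if_neg h3]
          simp
  have hi : i.val - 1 < n := by omega
  rw [h, Fin.sum_univ_eq_sum_range (fun j => (if j = i.val then d i * extendZero y i else 0) +
        (if j = i.val - 1 then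
          (if i.val = 0 then 0 else e (i - 1) * extendZero y (i - 1)) else 0)) n,
    Finset.sum_add_distrib, Finset.sum_ite_eq', Finset.sum_ite_eq',
    if_pos (Finset.mem_range.2 i.2), if_pos (Finset.mem_range.2 hi)]

/-- `q` solves the second order recurrence of `Aᵀ A`, where `A` is bidiagonal, with spectral
parameter `z`; the sequence `y` is the intermediate vector `A q`. -/
structure IsRecurrenceSolution (d e : ℕ → ℝ) (z : ℝ) (q y : ℕ → ℝ) : Prop where
  zero : q 0 = 1
  apply_right : ∀ i, d i * q i + e i * q (i + 1) = y i
  apply_left_zero : d 0 * y 0 = z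
  apply_left : ∀ i, d (i + 1) * y (i + 1) + e i * y i = z * q (i + 1)

namespace IsRecurrenceSolution

variable {d e : ℕ → ℝ} {z : ℝ} {q y : ℕ → ℝ} {n : ℕ}

/-- As no d i or e i vanishes, the equation can be solved upwards from the first entry, so
eigenspaces are at most lines. The case i = n, where the extension is 0, yields the boundary
condition q n = 0. -/
theorem eq_mul (h : IsRecurrenceSolution d e z q y) (hd : ∀ i, d i ≠ 0) (he : ∀ i, e i ≠ 0)
    {w : Fin n → ℝ}
    (hw : (bidiag n d e).transpose.mulVec ((bidiag n d e).mulVec w) = z • w) {i : ℕ} (hi : i ≤ n) :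
    extendZero w i = extendZero w 0 * q i := by
  have hy : ∀ i (_ : i < n), extendZero ((bidiag n d e).mulVec w) i =
      d i * extendZero w i + e i * extendZero w (i + 1) := fun i hi => by
    rw [extendZero, dif_pos hi, bidiag_mulVec]
  have key : ∀ i, (hi : i < n) → extendZero w i = extendZero w 0 * q i ∧
      extendZero ((bidiag n d e).mulVec w) i = extendZero w 0 * y i := by
    intro i
    induction i with
    | zero =>
      intro hi
      refine ⟨by rw [h.zero, mul_one], ?_⟩
      have h1 := congrFun hw ⟨0, hi⟩
      rw [bidiag_transpose_mulVec, Pi.smul_apply, smul_eq_mul, ← extendZero_val w] at h1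
      simp only [if_true, add_zero] at h1
      refine mul_left_cancel₀ (hd 0) ?_
      rw [h1, ← h.apply_left_zero]
      ring
    | succ i ih =>
      intro hi
      obtain ⟨ih1, ih2⟩ := ih (by omega)
      have hq : extendZero w (i + 1) = extendZero w 0 * q (i + 1) := by
        refine mul_left_cancel₀ (he i) ?_
        have h1 := hy i (by omega)
        rw [ih2, ih1] at h1
        linear_combination -h1 - extendZero w 0 * h.apply_right i
      refine ⟨hq, ?_⟩
      have h1 := congrFun hw ⟨i + 1, hi⟩
      rw [bidiag_transpose_mulVec, Pi.smul_apply, smul_eq_mul, ← extendZero_val w] at h1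
      simp only [Nat.succ_ne_zero, if_false, Nat.add_sub_cancel, ih2, hq] at h1
      refine mul_left_cancel₀ (hd (i + 1)) ?_
      linear_combination h1 - extendZero w 0 * h.apply_left i
  rcases hi.lt_or_eq with hi | rfl
  · exact (key i hi).1
  · rcases Nat.eq_zero_or_pos i with rfl | hpos
    · rw [h.zero, mul_one]
    · obtain ⟨m, rfl⟩ : ∃ m, i = m + 1 := ⟨i - 1, by omega⟩
      obtain ⟨h1, h2⟩ := key m (Nat.lt_succ_self m)
      have h3 := hy m (Nat.lt_succ_self m)
      rw [h2, h1] at h3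
      refine mul_left_cancel₀ (he m) ?_
      linear_combination -h3 - extendZero w 0 * h.apply_right m

/-- The matrix truncates the infinite recurrence only in its last row, where the missing term is a
multiple of q n. -/
theorem mulVec_eq (h : IsRecurrenceSolution d e z q y) (hq : q n = 0) :
    (bidiag n d e).transpose.mulVec ((bidiag n d e).mulVec fun i => q i) =
      z • fun i : Fin n => q i := by
  have hext : ∀ k ≤ n, extendZero (fun i : Fin n => q i) k = q k := fun k hk => by
    rcases hk.lt_or_eq with hk | rfl
    · simp [extendZero, hk]
    · rw [extendZero_of_le _ le_rfl, hq]
  have hy : (bidiag n d e).mulVec (fun i : Fin n => q i) = fun i : Fin n => y i := by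
    ext i
    rw [bidiag_mulVec, hext _ i.2.le, hext _ i.2, h.apply_right]
  have hexty : ∀ k < n, extendZero (fun i : Fin n => y i) k = y k := fun k hk => by
    simp [extendZero, hk]
  rw [hy]
  ext i
  rw [bidiag_transpose_mulVec, Pi.smul_apply, smul_eq_mul, hexty _ i.2]
  split_ifs with h0
  · rw [h0, add_zero, h.zero, mul_one, h.apply_left_zero]
  · obtain ⟨m, hm⟩ : ∃ m, i.val = m + 1 := ⟨i.val - 1, by omega⟩
    rw [hexty _ (by omega), hm, Nat.add_sub_cancel, h.apply_left]

end IsRecurrenceSolution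

theorem adjoint_comp_apply_eq_iff {n : ℕ} (A : Matrix (Fin n) (Fin n) ℝ) (z : ℝ)
    (w : EuclideanSpace ℝ (Fin n)) :
    (LinearMap.adjoint (Matrix.toEuclideanLin A) ∘ₗ Matrix.toEuclideanLin A) w = z • w ↔
      A.transpose.mulVec (A.mulVec w.ofLp) = z • w.ofLp := by
  rw [← Matrix.toEuclideanLin_conjTranspose_eq_adjoint, Matrix.conjTranspose_eq_transpose_of_trivial,
    ← (WithLp.ofLp_injective 2).eq_iff]
  rfl

/-- The squares of the singular values of a bidiagonal matrix with nonzero entries are simple, and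
they are the spectral parameters at which the solution of the recurrence vanishes at `n`. -/
theorem kthLeastSingularValue_bidiag {n : ℕ} {d e : ℕ → ℝ} {q y : ℝ → ℕ → ℝ}
    (hd : ∀ i, d i ≠ 0) (he : ∀ i, e i ≠ 0)
    (h : ∀ z, IsRecurrenceSolution d e z (q z) (y z)) :
    StrictMonoOn (fun k => kthLeastSingularValue (bidiag n d e) (k + 1) ^ 2) (Iio n) ∧
      ∀ z, q z n = 0 ↔ ∃ k < n, kthLeastSingularValue (bidiag n d e) (k + 1) ^ 2 = z := by
  set T := Matrix.toEuclideanLin (bidiag n d e)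
  have hn : Module.finrank ℝ (EuclideanSpace ℝ (Fin n)) = n := by simp
  set ev := T.isSymmetric_adjoint_comp_self.eigenvalues hn
  set B := T.isSymmetric_adjoint_comp_self.eigenvectorBasis hn
  -- The eigenvalues are listed in decreasing order from index 0, so the (k+1)-th least has index n
  -- - (k+1).
  have hsv : ∀ k (hk : k < n), kthLeastSingularValue (bidiag n d e) (k + 1) ^ 2 =
      ev ⟨n - (k + 1), by omega⟩ := fun k hk =>
    T.sq_singularValues_of_lt hn (by omega)
  have happ : ∀ i, (LinearMap.adjoint T ∘ₗ T) (B i) = ev i • B i := fun i =>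
    T.isSymmetric_adjoint_comp_self.apply_eigenvectorBasis hn i
  have hB : ∀ i j, B i j = extendZero (B i).ofLp 0 * q (ev i) j := fun i j => by
    rw [← (h (ev i)).eq_mul hd he ((adjoint_comp_apply_eq_iff _ _ _).1 (happ i)) j.2.le,
      extendZero_val]
  have hBne : ∀ i, extendZero (B i).ofLp 0 ≠ 0 := fun i h0 => by
    refine B.orthonormal.ne_zero i ?_
    ext j
    rw [hB, h0, zero_mul]
    rfl
  -- Equal eigenvalues would make two distinct orthonormal eigenvectors proportional, both being
  -- multiples of the same q.
  have hinj : Function.Injective ev := fun i j hij => by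
    by_contra hne
    have hprop : B i = (extendZero (B i).ofLp 0 / extendZero (B j).ofLp 0) • B j := by
      ext k
      have := hBne j
      rw [PiLp.smul_apply, hB i, hB j, hij, smul_eq_mul]
      field_simp
    have h0 : inner ℝ (B i) (B j) = 0 := B.orthonormal.2 hne
    rw [hprop, inner_smul_left, real_inner_self_eq_norm_sq, B.orthonormal.1 j] at h0
    simp [hBne] at h0
  have hanti : StrictAnti ev :=
    (T.isSymmetric_adjoint_comp_self.eigenvalues_antitone hn).strictAnti_of_injective hinj
  refine ⟨fun i hi j hj hij => ?_, fun z => ⟨fun hz => ?_, ?_⟩⟩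
  · simp only
    rw [hsv i hi, hsv j hj]
    refine hanti (Fin.mk_lt_mk.2 ?_)
    have := mem_Iio.1 hi
    have := mem_Iio.1 hj
    omega
  · have hev : Module.End.HasEigenvalue (LinearMap.adjoint T ∘ₗ T) z := by
      refine Module.End.hasEigenvalue_of_hasEigenvector
        (x := WithLp.toLp 2 fun i : Fin n => q z i) ⟨Module.End.mem_eigenspace_iff.2 ?_, ?_⟩
      · exact (adjoint_comp_apply_eq_iff _ _ _).2 ((h z).mulVec_eq hz)
      · intro h0
        have hn0 : 0 < n := by
          rcases Nat.eq_zero_or_pos n with rfl | hpos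
          · rw [(h z).zero] at hz
            exact absurd hz one_ne_zero
          · exact hpos
        have := congrFun (congrArg WithLp.ofLp h0) ⟨0, hn0⟩
        simp [(h z).zero] at this
    obtain ⟨i, hi⟩ := T.isSymmetric_adjoint_comp_self.exists_eigenvalues_eq hn hev
    refine ⟨n - (i + 1), by omega, ?_⟩
    rw [hsv _ (by omega)]
    have : (⟨n - (n - (i.val + 1) + 1), by omega⟩ : Fin n) = i := Fin.ext (by simp; omega)
    rw [this]
    simpa using hi
  · rintro ⟨k, hk, rfl⟩
    rw [hsv k hk]
    set i : Fin n := ⟨n - (k + 1), by omega⟩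
    have := (h (ev i)).eq_mul hd he ((adjoint_comp_apply_eq_iff _ _ _).1 (happ i)) le_rfl
    rw [extendZero_of_le _ le_rfl] at this
    exact (mul_eq_zero.1 this.symm).resolve_left (hBne i)

end JacobiBessel

/-! ### Entries of the scaled model and the bound on the remainder E. -/

namespace JacobiBessel

variable {a b : ℝ}

/-! ### Entries of the scaled model -/

theorem cos_arccos_sqrt {t : ℝ} (ht1 : t ≤ 1) :
    Real.cos (Real.arccos (Real.sqrt t)) = Real.sqrt t :=
  Real.cos_arccos (by linarith [Real.sqrt_nonneg t]) (Real.sqrt_le_one.2 ht1)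

theorem sin_arccos_sqrt {t : ℝ} (ht0 : 0 ≤ t) :
    Real.sin (Real.arccos (Real.sqrt t)) = Real.sqrt (1 - t) := by
  rw [Real.sin_arccos, Real.sq_sqrt ht0]

theorem cBar_succ (ha : -1 < a) (hb : -1 < b) (i : ℕ) :
    cBar a b (i + 1) = Real.sqrt ((a + (i + 1)) / (a + b + 2 * (i + 1))) := by
  have hi : (0 : ℝ) ≤ i := Nat.cast_nonneg i
  rw [cBar, thetaBar, cos_arccos_sqrt] <;> push_cast
  · rfl
  · rw [div_le_one (by linarith)]; linarith

theorem sBar_succ (ha : -1 < a) (hb : -1 < b) (i : ℕ) :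
    sBar a b (i + 1) = Real.sqrt ((b + (i + 1)) / (a + b + 2 * (i + 1))) := by
  have hi : (0 : ℝ) ≤ i := Nat.cast_nonneg i
  have h : a + b + 2 * ((i : ℝ) + 1) ≠ 0 := by linarith
  rw [sBar, thetaBar, sin_arccos_sqrt] <;> push_cast
  · rw [one_sub_div h]
    congr 2
    ring
  · exact div_nonneg (by linarith) (by linarith)

theorem cBar'_succ (ha : -1 < a) (hb : -1 < b) (i : ℕ) :
    cBar' a b (i + 1) = Real.sqrt ((i + 1) / (a + b + 1 + 2 * (i + 1))) := by
  have hi : (0 : ℝ) ≤ i := Nat.cast_nonneg i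
  rw [cBar', phiBar, cos_arccos_sqrt] <;> push_cast
  · rfl
  · rw [div_le_one (by linarith)]; linarith

theorem sBar'_succ (ha : -1 < a) (hb : -1 < b) (i : ℕ) :
    sBar' a b (i + 1) = Real.sqrt ((a + b + 1 + (i + 1)) / (a + b + 1 + 2 * (i + 1))) := by
  have hi : (0 : ℝ) ≤ i := Nat.cast_nonneg i
  have h : a + b + 1 + 2 * ((i : ℝ) + 1) ≠ 0 := by linarith
  rw [sBar', phiBar, sin_arccos_sqrt] <;> push_cast
  · rw [one_sub_div h]
    congr 2
    ring
  · exact div_nonneg (by linarith) (by linarith)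

/-- Diagonal entries of `F B₂₂ F`. -/
noncomputable def hardDiag (a b : ℝ) (i : ℕ) : ℝ :=
  if i = 0 then cBar a b 1 else cBar a b (i + 1) * sBar' a b i

/-- Superdiagonal entries of `F B₂₂ F`. -/
noncomputable def hardSuper (a b : ℝ) (i : ℕ) : ℝ := -(sBar a b (i + 1) * cBar' a b (i + 1))

theorem hardDiag_zero (ha : -1 < a) (hb : -1 < b) :
    hardDiag a b 0 = Real.sqrt ((a + 1) / (a + b + 2)) := by
  have := cBar_succ ha hb 0
  simp only [zero_add, Nat.cast_zero, mul_one] at this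
  rw [hardDiag, if_pos rfl, this]

theorem hardDiag_succ (ha : -1 < a) (hb : -1 < b) (i : ℕ) :
    hardDiag a b (i + 1) = Real.sqrt ((a + (i + 2)) * (a + b + (i + 2)) /
      ((a + b + 2 * (i + 2)) * (a + b + 2 * (i + 2) - 1))) := by
  have hi : (0 : ℝ) ≤ i := Nat.cast_nonneg i
  rw [hardDiag, if_neg (Nat.succ_ne_zero i), cBar_succ ha hb, sBar'_succ ha hb, ← Real.sqrt_mul]
  · congr 1
    push_cast
    rw [div_mul_div_comm]
    congr 1 <;> ring
  · push_cast
    exact div_nonneg (by linarith) (by linarith)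

theorem hardSuper_eq (ha : -1 < a) (hb : -1 < b) (i : ℕ) :
    hardSuper a b i = -Real.sqrt ((b + (i + 1)) * (i + 1) /
      ((a + b + 2 * (i + 1)) * (a + b + 2 * (i + 1) + 1))) := by
  have hi : (0 : ℝ) ≤ i := Nat.cast_nonneg i
  rw [hardSuper, sBar_succ ha hb, cBar'_succ ha hb, ← Real.sqrt_mul]
  · congr 2
    rw [div_mul_div_comm]
    congr 1
    ring
  · exact div_nonneg (by linarith) (by linarith)

theorem hardDiag_pos (ha : -1 < a) (hb : -1 < b) (i : ℕ) : 0 < hardDiag a b i := by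
  cases i with
  | zero =>
    rw [hardDiag_zero ha hb]
    exact Real.sqrt_pos.2 (div_pos (by linarith) (by linarith))
  | succ i =>
    have hi : (0 : ℝ) ≤ i := Nat.cast_nonneg i
    rw [hardDiag_succ ha hb]
    exact Real.sqrt_pos.2 (div_pos (mul_pos (by linarith) (by linarith))
      (mul_pos (by linarith) (by linarith)))

theorem hardSuper_radicand_pos (ha : -1 < a) (hb : -1 < b) (i : ℕ) :
    0 < (b + (i + 1)) * (i + 1) / ((a + b + 2 * (i + 1)) * (a + b + 2 * (i + 1) + 1)) := by
  have hi : (0 : ℝ) ≤ i := Nat.cast_nonneg i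
  exact div_pos (mul_pos (by linarith) (by linarith)) (mul_pos (by linarith) (by linarith))

theorem hardSuper_neg (ha : -1 < a) (hb : -1 < b) (i : ℕ) : hardSuper a b i < 0 := by
  rw [hardSuper_eq ha hb]
  exact neg_lt_zero.2 (Real.sqrt_pos.2 (hardSuper_radicand_pos ha hb i))

theorem hardDiag_zero_sq (ha : -1 < a) (hb : -1 < b) :
    hardDiag a b 0 ^ 2 = (a + 1) / (a + b + 2) := by
  rw [hardDiag_zero ha hb, Real.sq_sqrt (div_pos (by linarith) (by linarith)).le]

theorem hardDiag_succ_sq (ha : -1 < a) (hb : -1 < b) (i : ℕ) :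
    hardDiag a b (i + 1) ^ 2 = (a + (i + 2)) * (a + b + (i + 2)) /
      ((a + b + 2 * (i + 2)) * (a + b + 2 * (i + 2) - 1)) := by
  have hi : (0 : ℝ) ≤ i := Nat.cast_nonneg i
  rw [hardDiag_succ ha hb, Real.sq_sqrt (div_pos (mul_pos (by linarith) (by linarith))
      (mul_pos (by linarith) (by linarith))).le]

theorem hardSuper_sq (ha : -1 < a) (hb : -1 < b) (i : ℕ) :
    hardSuper a b i ^ 2 = (b + (i + 1)) * (i + 1) /
      ((a + b + 2 * (i + 1)) * (a + b + 2 * (i + 1) + 1)) := by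
  rw [hardSuper_eq ha hb, neg_sq, Real.sq_sqrt (hardSuper_radicand_pos ha hb i).le]

theorem flip_mul_mul_flip {n : ℕ} (A : Matrix (Fin n) (Fin n) ℝ) (i j : Fin n) :
    (flip n * A * flip n) i j = A i.rev j.rev := by
  have h : ∀ k : Fin n, (j = k.rev) ↔ (k = j.rev) := fun k => by
    rw [eq_comm, Fin.rev_eq_iff]
  simp [flip, Matrix.mul_apply, h]

/-- The flip reverses the order of the angles, so n enters the entries only through the factor 1/h.
-/
theorem jacobiHard_eq_bidiag (n : ℕ) (a b : ℝ) :
    jacobiHard n a b = bidiag n (fun i => 1 / meshSize n a b * hardDiag a b i)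
      (fun i => 1 / meshSize n a b * hardSuper a b i) := by
  ext i j
  rw [jacobiHard, Matrix.smul_apply, flip_mul_mul_flip, jacobiModel, Matrix.toBlocks_fromBlocks₂₂,
    smul_eq_mul, jacobiB22, bidiag, Matrix.of_apply, Matrix.of_apply]
  simp only [Fin.val_rev]
  have hi := i.2
  have hj := j.2
  by_cases h1 : j.val = i.val
  · rw [if_pos (by omega), if_pos h1, hardDiag]
    by_cases h2 : i.val = 0
    · rw [if_pos (by omega), if_pos h2]
    · rw [if_neg (by omega), if_neg h2, show n - (n - (i.val + 1)) = i.val + 1 by omega,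
        show n - (n - (i.val + 1) + 1) = i.val by omega]
  · by_cases h2 : j.val = i.val + 1
    · rw [if_neg (by omega), if_pos (by omega), if_neg h1, if_pos h2, hardSuper,
        show n - (n - (i.val + 1)) = i.val + 1 by omega]
    · rw [if_neg (by omega), if_neg (by omega), if_neg h1, if_neg h2, mul_zero]

theorem meshSize_pos (ha : -1 < a) (hb : -1 < b) {n : ℕ} (hn : 1 ≤ n) : 0 < meshSize n a b := by
  have : (1 : ℝ) ≤ n := by exact_mod_cast hn
  exact one_div_pos.2 (by linarith)

/-! ### Asymptotics of the entries -/

/-- If `q = r² + O(g)` with `r → 1/2`, then `√q = r + O(g)`. -/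
theorem isBigO_sqrt_sub {q r g : ℕ → ℝ} (hq : ∀ᶠ i in atTop, 0 ≤ q i)
    (hr : Tendsto r atTop (𝓝 (1 / 2)))
    (h : (fun i => q i - r i ^ 2) =O[atTop] g) : (fun i => Real.sqrt (q i) - r i) =O[atTop] g := by
  refine Asymptotics.IsBigO.trans (Asymptotics.IsBigO.of_bound 4 ?_) h
  filter_upwards [hq, hr.eventually_const_lt (show (1 / 4 : ℝ) < 1 / 2 by norm_num)] with i h1 h2
  have hs := Real.sqrt_nonneg (q i)
  -- The second factor eventually exceeds 1/4, whence the constant 4.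
  have e : q i - r i ^ 2 = (Real.sqrt (q i) - r i) * (Real.sqrt (q i) + r i) := by
    have := Real.sq_sqrt h1
    linear_combination -this
  rw [e, norm_mul, Real.norm_eq_abs, Real.norm_eq_abs,
    abs_of_pos (show 0 < Real.sqrt (q i) + r i by linarith)]
  nlinarith [abs_nonneg (Real.sqrt (q i) - r i)]

/-- A rational function `(α x + β) / (x² (x + γ))` in `x = 2 (i + 1) + δ` is `O(i⁻²)`. -/
theorem isBigO_rational (α β γ δ : ℝ) :
    (fun i : ℕ => (α * (2 * ((i : ℝ) + 1) + δ) + β) /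
      ((2 * ((i : ℝ) + 1) + δ) ^ 2 * (2 * ((i : ℝ) + 1) + δ + γ)))
      =O[atTop] fun i : ℕ => 1 / ((i : ℝ) + 1) ^ 2 := by
  refine Asymptotics.IsBigO.of_bound (|α| + |β|) ?_
  have hlim : Tendsto (fun i : ℕ => (i : ℝ) + 1) atTop atTop :=
    tendsto_atTop_add_const_right _ _ tendsto_natCast_atTop_atTop
  -- From here on both x and x + γ are at least m = i + 1.
  filter_upwards [hlim.eventually_ge_atTop (|δ| + 2 * |γ| + 1)] with i hi
  set m : ℝ := (i : ℝ) + 1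
  set x := 2 * m + δ
  have hδ := neg_abs_le δ
  have hγ := neg_abs_le γ
  have hδ0 := abs_nonneg δ
  have hγ0 := abs_nonneg γ
  have hm1 : 1 ≤ m := by linarith
  have hx : m ≤ x := by simp only [x]; linarith
  have hxγ : x / 2 ≤ x + γ := by linarith
  have hx1 : 1 ≤ x := by linarith
  have hxγ1 : 0 < x + γ := by linarith
  rw [norm_div, Real.norm_eq_abs, Real.norm_eq_abs, Real.norm_eq_abs,
    abs_of_pos (by positivity : 0 < x ^ 2 * (x + γ)),
    abs_of_pos (by positivity : 0 < 1 / m ^ 2), mul_one_div, div_le_div_iff₀ (by positivity)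
    (by positivity)]
  have hnum : |α * x + β| ≤ (|α| + |β|) * x := by
    refine (abs_add_le _ _).trans ?_
    rw [abs_mul, abs_of_pos (by linarith : 0 < x), add_mul]
    nlinarith [abs_nonneg β]
  have hden : x * m ^ 2 ≤ x ^ 2 * (x + γ) := by
    have h2 : m ^ 2 ≤ x * (x + γ) := by
      have : m ≤ x + γ := by simp only [x]; linarith
      nlinarith
    nlinarith
  have hnn : 0 ≤ |α| + |β| := by positivity
  calc |α * x + β| * m ^ 2 ≤ (|α| + |β|) * x * m ^ 2 := by gcongr
    _ = (|α| + |β|) * (x * m ^ 2) := by ring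
    _ ≤ _ := by gcongr

theorem tendsto_half_add (c δ : ℝ) :
    Tendsto (fun i : ℕ => 1 / 2 + c / (2 * ((i : ℝ) + 1) + δ)) atTop (𝓝 (1 / 2)) := by
  have h1 : Tendsto (fun i : ℕ => 2 * ((i : ℝ) + 1) + δ) atTop atTop :=
    tendsto_atTop_add_const_right _ _ ((tendsto_atTop_add_const_right _ _
      tendsto_natCast_atTop_atTop).const_mul_atTop two_pos)
  simpa using (h1.const_div_atTop c).const_add (1 / 2 : ℝ)

theorem isBigO_hardDiag (ha : -1 < a) (hb : -1 < b) :
    (fun i : ℕ => hardDiag a b i - (1 / 2 + (a + 1 / 2) / 2 / (2 * ((i : ℝ) + 1) + (a + b))))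
      =O[atTop] fun i : ℕ => 1 / ((i : ℝ) + 1) ^ 2 := by
  have hev : ∀ᶠ i : ℕ in atTop, hardDiag a b i = Real.sqrt (hardDiag a b i ^ 2) :=
    Eventually.of_forall fun i => (Real.sqrt_sq (hardDiag_pos ha hb i).le).symm
  refine Asymptotics.IsBigO.congr' (isBigO_sqrt_sub (q := fun i => hardDiag a b i ^ 2)
    (Eventually.of_forall fun i => sq_nonneg _) (tendsto_half_add ((a + 1 / 2) / 2) (a + b)) ?_)
    (hev.mono fun i hi => by simp only [← hi]) EventuallyEq.rfl
  -- Over the common denominator x²(x - 1), with x = a + b + 2(i + 1), the x² terms of the numerator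
  -- cancel, which is what fixes the coefficient a + 1/2. Row 0 has no s̄' factor and is left out.
  refine (isBigO_rational ((2 * a + 1 + (a ^ 2 - b ^ 2)) / 4 - (a + 1 / 2) ^ 2 / 4)
    ((a + 1 / 2) ^ 2 / 4) (-1) (a + b)).congr' ?_ EventuallyEq.rfl
  filter_upwards [eventually_ge_atTop 1] with i hi
  obtain ⟨m, rfl⟩ : ∃ m, i = m + 1 := ⟨i - 1, by omega⟩
  have hm : (0 : ℝ) ≤ m := Nat.cast_nonneg m
  rw [hardDiag_succ_sq ha hb]
  push_cast
  have h1 : a + b + 2 * ((m : ℝ) + 2) ≠ 0 := by linarith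
  have h2 : a + b + 2 * ((m : ℝ) + 2) - 1 ≠ 0 := by linarith
  obtain ⟨x, hx⟩ : ∃ x, x = a + b + 2 * ((m : ℝ) + 2) := ⟨_, rfl⟩
  have hm' : (m : ℝ) = (x - a - b) / 2 - 2 := by linarith
  rw [← hx] at h1 h2 ⊢
  rw [show 2 * ((m : ℝ) + 1 + 1) + (a + b) = x by linarith, hm', ← sub_eq_add_neg]
  field_simp
  ring

theorem isBigO_hardSuper (ha : -1 < a) (hb : -1 < b) :
    (fun i : ℕ => -hardSuper a b i -
      (1 / 2 + -((a + 1 / 2) / 2) / (2 * ((i : ℝ) + 1) + (a + b))))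
      =O[atTop] fun i : ℕ => 1 / ((i : ℝ) + 1) ^ 2 := by
  have hev : ∀ᶠ i : ℕ in atTop, -hardSuper a b i = Real.sqrt (hardSuper a b i ^ 2) :=
    Eventually.of_forall fun i => by
      rw [← neg_sq, Real.sqrt_sq (neg_pos.2 (hardSuper_neg ha hb i)).le]
  refine Asymptotics.IsBigO.congr' (isBigO_sqrt_sub (q := fun i => hardSuper a b i ^ 2)
    (Eventually.of_forall fun i => sq_nonneg _) (tendsto_half_add (-((a + 1 / 2) / 2)) (a + b)) ?_)
    (hev.mono fun i hi => by simp only [← hi]) EventuallyEq.rfl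
  refine (isBigO_rational ((a ^ 2 - b ^ 2 + (2 * a + 1)) / 4 - (a + 1 / 2) ^ 2 / 4)
    (-(a + 1 / 2) ^ 2 / 4) 1 (a + b)).congr' ?_ EventuallyEq.rfl
  refine Eventually.of_forall fun m => ?_
  have hm : (0 : ℝ) ≤ m := Nat.cast_nonneg m
  simp only
  rw [hardSuper_sq ha hb]
  have h1 : a + b + 2 * ((m : ℝ) + 1) ≠ 0 := by linarith
  have h2 : a + b + 2 * ((m : ℝ) + 1) + 1 ≠ 0 := by linarith
  obtain ⟨x, hx⟩ : ∃ x, x = a + b + 2 * ((m : ℝ) + 1) := ⟨_, rfl⟩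
  have hm' : (m : ℝ) = (x - a - b) / 2 - 1 := by linarith
  rw [← hx] at h1 h2 ⊢
  rw [show 2 * ((m : ℝ) + 1) + (a + b) = x by linarith, hm']
  field_simp
  ring

/-- The remainder of the approximation of the scaled model by a discretized Bessel operator. -/
noncomputable def hardRemainder (n : ℕ) (a b : ℝ) : Matrix (Fin n) (Fin n) ℝ :=
  bidiag n
    (fun i => 1 / meshSize n a b *
      (hardDiag a b i - (1 / 2 + (a + 1 / 2) / 2 / (2 * ((i : ℝ) + 1) + (a + b)))))
    (fun i => -(1 / meshSize n a b *
      (-hardSuper a b i - (1 / 2 + -((a + 1 / 2) / 2) / (2 * ((i : ℝ) + 1) + (a + b))))))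

theorem jacobiHard_eq_add_hardRemainder (ha : -1 < a) (hb : -1 < b) {n : ℕ} (hn : 1 ≤ n) :
    jacobiHard n a b =
      -((1 / (2 * meshSize n a b)) • nabla n) +
        (a + 1 / 2) • (Matrix.diagonal (fun i : Fin n => 1 / gridPoint n a b (2 * (i.val + 1))) *
          interp n) + hardRemainder n a b := by
  have hh := (meshSize_pos ha hb hn).ne'
  rw [jacobiHard_eq_bidiag]
  ext i j
  have hi : (0 : ℝ) ≤ i.val := Nat.cast_nonneg i.val
  have hg : 2 * ((i.val : ℝ) + 1) + (a + b) ≠ 0 := by linarith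
  have hg' : a + b + 2 * ((i.val : ℝ) + 1) ≠ 0 := by linarith
  simp only [Matrix.add_apply, Matrix.neg_apply, Matrix.smul_apply, smul_eq_mul,
    Matrix.diagonal_mul, interp_apply, bidiag, hardRemainder, nabla, Matrix.of_apply, gridPoint]
  push_cast
  by_cases h1 : j.val = i.val
  · simp only [h1, if_true, true_or]
    field_simp
    ring
  · by_cases h2 : j.val = i.val + 1
    · simp only [h2, if_true, or_true, if_neg (Nat.succ_ne_self i.val)]
      field_simp
      ring
    · simp [h1, h2]

theorem isUpperBidiagonal_bidiag (n : ℕ) (d e : ℕ → ℝ) : IsUpperBidiagonal (bidiag n d e) := by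
  intro i j h1 h2
  simp [bidiag, h1, h2]

/-- The remainder is at most a constant times m⁻²/h in row m, and m ≥ ε/h turns this into h/ε². -/
theorem hardRemainder_bound (ha : -1 < a) (hb : -1 < b) {ε : ℝ} (hε : 0 < ε) :
    ∃ C : ℝ, ∀ n : ℕ, 1 ≤ n → ∀ i j : Fin n, ⌈ε / meshSize n a b⌉₊ ≤ i.val + 1 →
      |hardRemainder n a b i j| ≤ C * meshSize n a b := by
  obtain ⟨C₁, hC₁, h₁⟩ := Asymptotics.bound_of_isBigO_nat_atTop (isBigO_hardDiag ha hb)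
  obtain ⟨C₂, hC₂, h₂⟩ := Asymptotics.bound_of_isBigO_nat_atTop (isBigO_hardSuper ha hb)
  refine ⟨max C₁ C₂ / ε ^ 2, fun n hn i j hij => ?_⟩
  set h := meshSize n a b
  have hh : 0 < h := meshSize_pos ha hb hn
  set m : ℝ := (i.val : ℝ) + 1
  have hm0 : 0 < m := by positivity
  have hm : ε / h ≤ m := (Nat.le_ceil _).trans (by simp only [m]; exact_mod_cast hij)
  have hne : 1 / m ^ 2 ≠ 0 := by positivity
  have hC : 0 < max C₁ C₂ := lt_max_of_lt_left hC₁
  have key : 1 / h * (max C₁ C₂ * (1 / m ^ 2)) ≤ max C₁ C₂ / ε ^ 2 * h := by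
    have : (ε / h) ^ 2 ≤ m ^ 2 := pow_le_pow_left₀ (by positivity) hm 2
    calc 1 / h * (max C₁ C₂ * (1 / m ^ 2)) ≤ 1 / h * (max C₁ C₂ * (1 / (ε / h) ^ 2)) := by
          gcongr
      _ = _ := by field_simp
  have hnorm : ‖1 / m ^ 2‖ = 1 / m ^ 2 := Real.norm_of_nonneg (by positivity)
  have hd := h₁ hne
  have he := h₂ hne
  rw [hnorm, Real.norm_eq_abs] at hd he
  have hinv : 0 < 1 / h := by positivity
  have hpos : 0 < 1 / m ^ 2 := by positivity
  rw [hardRemainder, bidiag, Matrix.of_apply]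
  split_ifs
  · rw [abs_mul, abs_of_pos hinv]
    refine (mul_le_mul_of_nonneg_left (hd.trans ?_) hinv.le).trans key
    exact mul_le_mul_of_nonneg_right (le_max_left _ _) hpos.le
  · rw [abs_neg, abs_mul, abs_of_pos hinv]
    refine (mul_le_mul_of_nonneg_left (he.trans ?_) hinv.le).trans key
    exact mul_le_mul_of_nonneg_right (le_max_right _ _) hpos.le
  · rw [abs_zero]
    positivity

end JacobiBessel

/-! ### Singular values of the model as zeros of Jacobi polynomials, and their limit. -/

namespace JacobiBessel

variable {a b : ℝ}

/-! ### Singular values of the scaled model as zeros of Jacobi polynomials -/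

/-- Ratio of the entries of a singular vector to the values of Jacobi polynomials. -/
noncomputable def normFactor (a b : ℝ) (i : ℕ) : ℝ :=
  ∏ j ∈ Finset.range i, -(hardDiag a b j / hardSuper a b j)

theorem normFactor_ne_zero (ha : -1 < a) (hb : -1 < b) (i : ℕ) : normFactor a b i ≠ 0 :=
  Finset.prod_ne_zero_iff.2 fun j _ =>
    neg_ne_zero.2 (div_ne_zero (hardDiag_pos ha hb j).ne' (hardSuper_neg ha hb j).ne)

/-- This normalization turns A q into a multiple of the difference of consecutive Jacobi
polynomials. -/
theorem hardSuper_mul_normFactor_succ (ha : -1 < a) (hb : -1 < b) (i : ℕ) :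
    hardSuper a b i * normFactor a b (i + 1) = -(hardDiag a b i * normFactor a b i) := by
  have := (hardSuper_neg ha hb i).ne
  rw [normFactor, Finset.prod_range_succ, ← normFactor]
  field_simp

theorem isRecurrenceSolution_jacobiPoly (ha : -1 < a) (hb : -1 < b) {h : ℝ} (hh : h ≠ 0) (z : ℝ) :
    IsRecurrenceSolution (fun i => 1 / h * hardDiag a b i) (fun i => 1 / h * hardSuper a b i) z
      (fun i => normFactor a b i * jacobiPoly a b i (h ^ 2 * z))
      (fun i => 1 / h * hardDiag a b i * normFactor a b i *
        (jacobiPoly a b i (h ^ 2 * z) - jacobiPoly a b (i + 1) (h ^ 2 * z))) where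
  zero := by simp [normFactor, jacobiPoly, hypPoly_zero_left]
  apply_right i := by
    have := hardSuper_mul_normFactor_succ ha hb i
    linear_combination 1 / h * jacobiPoly a b (i + 1) (h ^ 2 * z) * this
  apply_left_zero := by
    have h1 := jacobiPoly_sub_succ (b := b) ha 0 (h ^ 2 * z)
    have h2 := hardDiag_zero_sq ha hb
    have ha1 : a + 1 ≠ 0 := by linarith
    have hab : a + b + 2 ≠ 0 := by linarith
    rw [hypPoly_zero_left] at h1
    have h3 : jacobiPoly a b 0 (h ^ 2 * z) - jacobiPoly a b (0 + 1) (h ^ 2 * z) =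
        h ^ 2 * z * (a + b + 2) / (a + 1) := by
      rw [eq_div_iff ha1, mul_comm, h1]
      simp
    have h4 : 1 / h * hardDiag a b 0 * (1 / h * hardDiag a b 0 * normFactor a b 0 *
        (jacobiPoly a b 0 (h ^ 2 * z) - jacobiPoly a b (0 + 1) (h ^ 2 * z))) =
        hardDiag a b 0 ^ 2 / h ^ 2 * (h ^ 2 * z * (a + b + 2) / (a + 1)) := by
      rw [h3]
      simp only [normFactor, Finset.range_zero, Finset.prod_empty]
      ring
    rw [h4, h2]
    field_simp
  apply_left i := by
    have h0 := hardSuper_mul_normFactor_succ ha hb i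
    have h1 := jacobiPoly_sub_succ (b := b) ha i (h ^ 2 * z)
    have h2 := jacobiPoly_sub_succ (b := b) ha (i + 1) (h ^ 2 * z)
    have h3 := jacobiPoly_succ_eq (b := b) ha i (h ^ 2 * z)
    have hi : (0 : ℝ) ≤ i := Nat.cast_nonneg i
    have ha1 : a + 1 ≠ 0 := by linarith
    have hA : a + b + 2 * ((i : ℝ) + 2) ≠ 0 := by linarith
    have hB : a + b + 2 * ((i : ℝ) + 2) - 1 ≠ 0 := by linarith
    have hC : a + b + 2 * ((i : ℝ) + 1) ≠ 0 := by linarith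
    have hd : hardDiag a b (i + 1) ^ 2 * (a + b + 2 * (i + 2)) * (a + b + 2 * (i + 2) - 1) =
        (a + (i + 2)) * (a + b + (i + 2)) := by
      rw [hardDiag_succ_sq ha hb]
      field_simp
    have he : hardSuper a b i ^ 2 * (a + b + 2 * (i + 1)) * (a + b + 2 * (i + 2) - 1) =
        (b + (i + 1)) * (i + 1) := by
      rw [hardSuper_sq ha hb, show a + b + 2 * ((i : ℝ) + 2) - 1 = a + b + 2 * (i + 1) + 1 by ring]
      have : a + b + 2 * ((i : ℝ) + 1) + 1 ≠ 0 := by linarith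
      rw [div_mul_eq_mul_div, div_mul_eq_mul_div, div_eq_iff (mul_ne_zero hC this)]
      ring
    push_cast at h2 h3
    set p := jacobiPoly a b i (h ^ 2 * z)
    set p₁ := jacobiPoly a b (i + 1) (h ^ 2 * z)
    set p₂ := jacobiPoly a b (i + 1 + 1) (h ^ 2 * z)
    set r := hypPoly i (i + (a + b + 2)) (a + 2) (h ^ 2 * z)
    set r₁ := hypPoly (i + 1) (i + 1 + (a + b + 2)) (a + 2) (h ^ 2 * z)
    set D := hardDiag a b (i + 1)
    set e := hardSuper a b i
    -- The row equation freed of normalizing factors. By the difference formula each bracket is x =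
    -- h²z times a polynomial of parameter a + 1, and the backward relation recombines these into
    -- p₁.
    have key : D ^ 2 * (p₁ - p₂) - e ^ 2 * (p - p₁) = h ^ 2 * z * p₁ := by
      refine mul_left_cancel₀ ha1 (mul_left_cancel₀ hB ?_)
      linear_combination (a + b + 2 * (i + 2) - 1) * D ^ 2 * h2 -
        (a + b + 2 * (i + 2) - 1) * e ^ 2 * h1 + h ^ 2 * z * h3 + h ^ 2 * z * r₁ * hd -
        h ^ 2 * z * r * he
    have hz : z * p₁ = (D ^ 2 * (p₁ - p₂) - e ^ 2 * (p - p₁)) / h ^ 2 := by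
      rw [key]
      field_simp
    linear_combination e * (p - p₁) / h ^ 2 * h0 - normFactor a b (i + 1) * hz

/-! ### Mehler-Heine asymptotics -/

/-- The Taylor coefficients of the rescaled Jacobi polynomials. -/
noncomputable def scaledCoeff (a b : ℝ) (n k : ℕ) : ℝ :=
  hypCoeff (-n) (n + (a + b + 1)) (a + 1) k * (meshSize n a b ^ 2) ^ k

theorem jacobiPoly_scaled (a b : ℝ) (n : ℕ) (z : ℝ) :
    jacobiPoly a b n (meshSize n a b ^ 2 * z) = ∑' k, scaledCoeff a b n k * z ^ k := by
  rw [jacobiPoly, hypPoly]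
  refine tsum_congr fun k => ?_
  rw [scaledCoeff, mul_pow, mul_assoc]

theorem scaledCoeff_eq_prod (a b : ℝ) (n k : ℕ) :
    scaledCoeff a b n k = ∏ j ∈ Finset.range k, ((-(n : ℝ) + j) * meshSize n a b *
      ((n + (a + b + 1) + j) * meshSize n a b) * ((a + 1 + j) * (j + 1))⁻¹) := by
  have hpow : (meshSize n a b ^ 2) ^ k = ∏ _j ∈ Finset.range k, meshSize n a b ^ 2 := by simp
  rw [scaledCoeff, hypCoeff, hpow, ← Finset.prod_mul_distrib]
  refine Finset.prod_congr rfl fun j _ => ?_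
  rw [div_eq_mul_inv, add_comm 1 (j : ℝ)]
  ring

/-- Terms with k > n vanish. For j < k ≤ n both n - j and n + a + b + 1 + j are at most 1/h = 2n + a
+ b + 1, so pairing each with one h leaves factors of modulus at most 1. -/
theorem abs_scaledCoeff_le (ha : -1 < a) (hb : -1 < b) {n : ℕ} (hn : 1 ≤ n) (k : ℕ) :
    |scaledCoeff a b n k| ≤ limCoeff a k := by
  rcases lt_or_ge n k with hk | hk
  · rw [scaledCoeff, hypCoeff_neg_eq_zero _ _ _ hk, zero_mul, abs_zero]
    exact (limCoeff_pos ha k).le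
  rw [scaledCoeff_eq_prod, Finset.abs_prod, limCoeff]
  refine Finset.prod_le_prod (fun j _ => abs_nonneg _) fun j hj => ?_
  have hj0 : (0 : ℝ) ≤ j := Nat.cast_nonneg j
  have hjn : (j : ℝ) ≤ n := by
    exact_mod_cast ((Finset.mem_range.1 hj).trans_le hk).le
  have hn1 : (1 : ℝ) ≤ n := by exact_mod_cast hn
  have hden : 0 < 2 * (n : ℝ) + a + b + 1 := by linarith
  have hinv : 0 < ((a + 1 + j) * ((j : ℝ) + 1))⁻¹ := inv_pos.2 (mul_pos (by linarith) (by linarith))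
  have h1 : |(-(n : ℝ) + j) * meshSize n a b| ≤ 1 := by
    rw [meshSize, mul_one_div, abs_div, abs_of_pos hden, div_le_one hden, abs_le]
    constructor <;> linarith
  have h2 : |((n : ℝ) + (a + b + 1) + j) * meshSize n a b| ≤ 1 := by
    rw [meshSize, mul_one_div, abs_div, abs_of_pos hden, div_le_one hden, abs_le]
    constructor <;> linarith
  rw [abs_mul, abs_mul, abs_of_pos hinv]
  exact mul_le_of_le_one_left hinv.le (mul_le_one₀ h1 (abs_nonneg _) h2)

/-- Each n-dependent linear factor times h tends to ±1/2, and each pair contributes -1/4. -/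
theorem tendsto_scaledCoeff (a b : ℝ) (k : ℕ) :
    Tendsto (fun n => scaledCoeff a b n k) atTop (𝓝 (limCoeff a k * (-(1 / 4)) ^ k)) := by
  have hden : Tendsto (fun n : ℕ => 2 * (n : ℝ) + (a + b + 1)) atTop atTop :=
    tendsto_atTop_add_const_right _ _ (tendsto_natCast_atTop_atTop.const_mul_atTop two_pos)
  have hden0 : ∀ᶠ n : ℕ in atTop, 2 * (n : ℝ) + (a + b + 1) ≠ 0 := hden.eventually_ne_atTop 0
  have hlin : ∀ c : ℝ, Tendsto (fun n : ℕ => ((n : ℝ) + c) * meshSize n a b) atTop (𝓝 (1 / 2)) := by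
    intro c
    have h1 := (hden.const_div_atTop (c - (a + b + 1) / 2)).const_add (1 / 2 : ℝ)
    rw [add_zero] at h1
    refine h1.congr' ?_
    filter_upwards [hden0] with n hn
    rw [meshSize, show 2 * (n : ℝ) + a + b + 1 = 2 * (n : ℝ) + (a + b + 1) by ring]
    field_simp
    ring
  have hprod : limCoeff a k * (-(1 / 4)) ^ k =
      ∏ j ∈ Finset.range k, (-(1 / 2 : ℝ) * (1 / 2) * ((a + 1 + j) * (j + 1))⁻¹) := by
    rw [Finset.prod_mul_distrib, Finset.prod_const, Finset.card_range, limCoeff, mul_comm]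
    norm_num
  rw [hprod]
  simp_rw [scaledCoeff_eq_prod]
  refine tendsto_finsetProd _ fun j _ => Tendsto.mul_const _ (Tendsto.mul ?_ ?_)
  · refine (hlin (-j)).neg.congr fun n => ?_
    ring
  · refine (hlin (a + b + 1 + j)).congr fun n => ?_
    ring

theorem hypLim_neg_div_four (a z : ℝ) :
    hypLim a (-(z / 4)) = ∑' k, limCoeff a k * (-(1 / 4)) ^ k * z ^ k := by
  refine tsum_congr fun k => ?_
  rw [mul_assoc, ← mul_pow]
  congr 2
  ring

theorem hasDerivAt_hypLim_neg_div_four (ha : -1 < a) (z : ℝ) :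
    HasDerivAt (fun z => hypLim a (-(z / 4))) (-(hypLim (a + 1) (-(z / 4)) / (4 * (a + 1)))) z := by
  have h1 : HasDerivAt (fun z : ℝ => -(z / 4)) (-(1 / 4)) z := ((hasDerivAt_id z).div_const 4).neg
  refine ((hasDerivAt_hypLim ha (-(z / 4))).comp z h1).congr_deriv ?_
  have : a + 1 ≠ 0 := by linarith
  field_simp

theorem hasDerivAt_jacobiPoly_scaled (ha : -1 < a) (hb : -1 < b) {n : ℕ} (hn : 1 ≤ n) (z : ℝ) :
    HasDerivAt (fun z => jacobiPoly a b n (meshSize n a b ^ 2 * z))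
      (∑' k : ℕ, ((k : ℝ) + 1) * scaledCoeff a b n (k + 1) * z ^ k) z := by
  simp_rw [jacobiPoly_scaled]
  exact hasDerivAt_tsum_mul_pow (abs_scaledCoeff_le ha hb hn)
    (fun R _ => summable_limCoeff_deriv ha R) z

theorem tendstoUniformlyOn_jacobiPoly_scaled (ha : -1 < a) (hb : -1 < b) {R : ℝ} (hR : 0 ≤ R) :
    TendstoUniformlyOn (fun n z => jacobiPoly a b n (meshSize n a b ^ 2 * z))
      (fun z => hypLim a (-(z / 4))) atTop (Icc 0 R) := by
  simp_rw [jacobiPoly_scaled, hypLim_neg_div_four]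
  refine tendstoUniformlyOn_tsum_mul_pow hR (summable_limCoeff ha R) ?_ (tendsto_scaledCoeff a b)
  filter_upwards [eventually_ge_atTop 1] with n hn
  exact abs_scaledCoeff_le ha hb hn

theorem tendstoUniformlyOn_deriv_jacobiPoly_scaled (ha : -1 < a) (hb : -1 < b) {R : ℝ}
    (hR : 0 ≤ R) :
    TendstoUniformlyOn (fun n z => ∑' k : ℕ, ((k : ℝ) + 1) * scaledCoeff a b n (k + 1) * z ^ k)
      (fun z => -(hypLim (a + 1) (-(z / 4)) / (4 * (a + 1)))) atTop (Icc 0 R) := by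
  have hlim : (fun z => -(hypLim (a + 1) (-(z / 4)) / (4 * (a + 1)))) = fun z =>
      ∑' k : ℕ, ((k : ℝ) + 1) * (limCoeff a (k + 1) * (-(1 / 4)) ^ (k + 1)) * z ^ k := by
    ext z
    have h := hasDerivAt_tsum_mul_pow (c := fun k => limCoeff a k * (-(1 / 4)) ^ k)
      (g := limCoeff a) (fun k => ?_) (fun R _ => summable_limCoeff_deriv ha R) z
    · simp_rw [← hypLim_neg_div_four] at h
      exact (hasDerivAt_hypLim_neg_div_four ha z).unique h
    · rw [abs_mul, abs_of_pos (limCoeff_pos ha k), abs_pow]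
      refine mul_le_of_le_one_right (limCoeff_pos ha k).le (pow_le_one₀ (abs_nonneg _) ?_)
      rw [abs_neg, abs_of_pos] <;> norm_num
  rw [hlim]
  refine tendstoUniformlyOn_tsum_mul_pow
    (c := fun n k => ((k : ℝ) + 1) * scaledCoeff a b n (k + 1))
    (c₀ := fun k => ((k : ℝ) + 1) * (limCoeff a (k + 1) * (-(1 / 4)) ^ (k + 1))) hR
    (summable_limCoeff_deriv ha R) ?_ fun k => (tendsto_scaledCoeff a b (k + 1)).const_mul _
  filter_upwards [eventually_ge_atTop 1] with n hn k
  have hk : (0 : ℝ) ≤ (k : ℝ) + 1 := by positivity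
  rw [abs_mul, abs_of_nonneg hk]
  exact mul_le_mul_of_nonneg_left (abs_scaledCoeff_le ha hb hn (k + 1)) hk

/-! ### Convergence of the singular values -/

theorem kthLeastSingularValue_nonneg {n : ℕ} (A : Matrix (Fin n) (Fin n) ℝ) (k : ℕ) :
    0 ≤ kthLeastSingularValue A k :=
  LinearMap.singularValues_nonneg _ _

theorem kthLeastSingularValue_jacobiHard (ha : -1 < a) (hb : -1 < b) {n : ℕ} (hn : 1 ≤ n) :
    StrictMonoOn (fun k => kthLeastSingularValue (jacobiHard n a b) (k + 1) ^ 2) (Iio n) ∧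
      ∀ z, jacobiPoly a b n (meshSize n a b ^ 2 * z) = 0 ↔
        ∃ k < n, kthLeastSingularValue (jacobiHard n a b) (k + 1) ^ 2 = z := by
  have hh := (meshSize_pos ha hb hn).ne'
  have hinv : 1 / meshSize n a b ≠ 0 := one_div_ne_zero hh
  have h := kthLeastSingularValue_bidiag (n := n)
    (fun i => mul_ne_zero hinv (hardDiag_pos ha hb i).ne')
    (fun i => mul_ne_zero hinv (hardSuper_neg ha hb i).ne)
    (isRecurrenceSolution_jacobiPoly ha hb hh)
  rw [jacobiHard_eq_bidiag]
  refine ⟨h.1, fun z => ?_⟩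
  rw [← h.2 z, mul_eq_zero, or_iff_right (normFactor_ne_zero ha hb n)]

theorem hypLim_neg_div_four_simple (ha : -1 < a) {z : ℝ} (hz : 0 < z)
    (h : hypLim a (-(z / 4)) = 0) : -(hypLim (a + 1) (-(z / 4)) / (4 * (a + 1))) ≠ 0 := by
  have h1 := hypLim_succ_ne_zero ha (Real.sqrt_pos.2 hz)
  rw [Real.sq_sqrt hz.le] at h1
  have : 4 * (a + 1) ≠ 0 := by linarith
  exact neg_ne_zero.2 (div_ne_zero (h1 h) this)

theorem exists_strictMono_hypLim_zeros (ha : -1 < a) :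
    ∃ ζ : ℕ → ℝ, StrictMono ζ ∧ range ζ = {z | 0 < z ∧ hypLim a (-(z / 4)) = 0} := by
  refine exists_strictMono_range_eq (fun R => ?_) fun R => ?_
  · refine (finite_zeros_Icc (p := 0) (q := R) (hasDerivAt_hypLim_neg_div_four ha)
      fun x hx hx0 => ?_).subset fun z hz => ⟨⟨hz.1.1.le, hz.2⟩, hz.1.2⟩
    rcases hx.1.eq_or_lt with rfl | h
    · simp [hypLim_zero] at hx0
    · exact hypLim_neg_div_four_simple ha h hx0
  · obtain ⟨x, hx, hx0, hzero⟩ := exists_hypLim_eq_zero ha (max R 1)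
    have h1 : 1 < x := (le_max_right _ _).trans_lt hx
    have h2 : R < x := (le_max_left _ _).trans_lt hx
    exact ⟨x ^ 2, ⟨by positivity, hzero⟩, by nlinarith⟩

/-- The zero argument runs in z = σ², where polynomials and limit are power series; square roots are
taken at the end. Zero is never a singular value, since each polynomial equals 1 at 0. -/
theorem tendsto_kthLeastSingularValue_jacobiHard (ha : -1 < a) (hb : -1 < b) {ζ : ℕ → ℝ}
    (hζ : StrictMono ζ) (hζr : range ζ = {z | 0 < z ∧ hypLim a (-(z / 4)) = 0}) (k : ℕ) :
    Tendsto (fun n => kthLeastSingularValue (jacobiHard n a b) (k + 1)) atTop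
      (𝓝 (Real.sqrt (ζ k))) := by
  have hcont : Continuous fun z => -(hypLim (a + 1) (-(z / 4)) / (4 * (a + 1))) :=
    (((continuous_hypLim (by linarith)).comp (by fun_prop)).div_const _).neg
  have h := tendsto_kth_zero (hasDerivAt_hypLim_neg_div_four ha) hcont
    ((eventually_ge_atTop 1).mono fun n hn => hasDerivAt_jacobiPoly_scaled ha hb hn)
    (fun R hR => tendstoUniformlyOn_jacobiPoly_scaled ha hb hR)
    (fun R hR => tendstoUniformlyOn_deriv_jacobiPoly_scaled ha hb hR)
    (by simp [hypLim_zero]) hζ hζr (fun x hx => hypLim_neg_div_four_simple ha hx)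
    (μ := fun n k => kthLeastSingularValue (jacobiHard n a b) (k + 1) ^ 2)
    ((eventually_ge_atTop 1).mono fun n hn =>
      ⟨(kthLeastSingularValue_jacobiHard ha hb hn).1,
        fun z _ => (kthLeastSingularValue_jacobiHard ha hb hn).2 z⟩)
    ((eventually_ge_atTop 1).mono fun n hn j hj => by
      refine lt_of_le_of_ne (sq_nonneg _) fun h0 => ?_
      have := ((kthLeastSingularValue_jacobiHard ha hb hn).2 0).2 ⟨j, hj, h0.symm⟩
      rw [mul_zero, jacobiPoly, hypPoly_zero_right] at this
      exact one_ne_zero this) k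
  refine (h.sqrt).congr fun n => ?_
  exact Real.sqrt_sq (kthLeastSingularValue_nonneg _ _)

theorem range_sqrt_eq_besselZeros (ha : -1 < a) {ζ : ℕ → ℝ}
    (hζr : range ζ = {z | 0 < z ∧ hypLim a (-(z / 4)) = 0}) :
    range (fun k => Real.sqrt (ζ k)) = besselZeros a := by
  rw [besselZeros_eq ha]
  ext x
  constructor
  · rintro ⟨k, rfl⟩
    have : ζ k ∈ range ζ := mem_range_self k
    rw [hζr] at this
    exact ⟨Real.sqrt_pos.2 this.1, by rw [Real.sq_sqrt this.1.le]; exact this.2⟩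
  · rintro ⟨hx, hx0⟩
    have : x ^ 2 ∈ range ζ := by rw [hζr]; exact ⟨by positivity, hx0⟩
    obtain ⟨k, hk⟩ := this
    exact ⟨k, by simp only [hk]; exact Real.sqrt_sq hx.le⟩

end JacobiBessel

theorem mainTheorem5 (a b : ℝ) (ha : -1 < a) (hb : -1 < b) :
    (∃ E : (n : ℕ) → Matrix (Fin n) (Fin n) ℝ,
      (∀ n : ℕ, 1 ≤ n →
        JacobiBessel.jacobiHard n a b =
          -((1 / (2 * JacobiBessel.meshSize n a b)) • JacobiBessel.nabla n)
            + (a + 1 / 2) •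
              (Matrix.diagonal
                  (fun i : Fin n => 1 / JacobiBessel.gridPoint n a b (2 * (i.val + 1))) *
                JacobiBessel.interp n)
            + E n) ∧
      (∀ n : ℕ, 1 ≤ n → JacobiBessel.IsUpperBidiagonal (E n)) ∧
      (∀ ε : ℝ, 0 < ε → ∃ C : ℝ, ∀ n : ℕ, 1 ≤ n → ∀ i j : Fin n,
        ⌈ε / JacobiBessel.meshSize n a b⌉₊ ≤ i.val + 1 →
          |E n i j| ≤ C * JacobiBessel.meshSize n a b)) ∧
    (∃ σ : ℕ → ℝ, StrictMono σ ∧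
      Set.range σ = JacobiBessel.besselZeros a ∧
      Set.range σ = JacobiBessel.besselSingularValues a ∧
      ∀ k : ℕ, Filter.Tendsto
        (fun n : ℕ =>
          JacobiBessel.kthLeastSingularValue (JacobiBessel.jacobiHard n a b) (k + 1))
        Filter.atTop (nhds (σ k))) := by
  refine ⟨⟨fun n => JacobiBessel.hardRemainder n a b,
    fun n hn => JacobiBessel.jacobiHard_eq_add_hardRemainder ha hb hn,
    fun n _ => JacobiBessel.isUpperBidiagonal_bidiag n _ _,
    fun ε hε => JacobiBessel.hardRemainder_bound ha hb hε⟩, ?_⟩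
  obtain ⟨ζ, hζ, hζr⟩ := JacobiBessel.exists_strictMono_hypLim_zeros ha
  have hr := JacobiBessel.range_sqrt_eq_besselZeros ha hζr
  refine ⟨fun k => Real.sqrt (ζ k), fun i j hij => ?_, hr,
    hr.trans (JacobiBessel.besselSingularValues_eq ha).symm,
    fun k => JacobiBessel.tendsto_kthLeastSingularValue_jacobiHard ha hb hζ hζr k⟩
  have hi : ζ i ∈ range ζ := mem_range_self i
  rw [hζr] at hi
  exact Real.sqrt_lt_sqrt hi.1.le (hζ hij)
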